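/- Let $d\ge 1$, let $\sigma\in C^\infty(\mathbb R^d\times\mathbb R^d;\mathbb C)$ satisfy $\sigma(x,\eta)=0$ for $|x|+|\eta|\ge R$, for some $R>0$, and let $\Phi$ be a real-valued $C^\infty$ function on $\mathbb R^d\times(\mathbb R^d\setminus\{0\})$ which is positively homogeneous of degree $1$ in $\eta$, i.e. $\Phi(x,t\eta)=t\,\Phi(x,\eta)$ for all $x\in\mathbb R^d$, $\eta\ne 0$, $t>0$ (no non-degeneracy of $\Phi$ is assumed). For $u\in\mathcal S(\mathbb R^d)$ put $$Tu(x)=\int_{\mathbb R^d} e^{2\pi i\Phi(x,\eta)}\sigma(x,\eta)\,\hat u(\eta)\,d\eta,\qquad \hat u(\eta)=\int_{\mathbb R^d} u(t)e^{-2\pi i t\cdot\eta}\,dt .$$ Fix a window $g\in\mathcal S(\mathbb R^d)$, $g\neq 0$, and for $f\in\mathcal S'(\mathbb R^d)$ let $V_gf(x,\eta)=\langle f,M_\eta T_xg\rangle$ be its short-time Fourier transform, where $M_\eta T_xg(y)=e^{2\pi i\eta\cdot y}g(y-x)$ and $\langle\cdot,\cdot\rangle$ extends the inner product $\int f\overline{h}$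 of $L^2(\mathbb R^d)$. For $1\le p\le\infty$ let $M^p$ be the space of all $f\in\mathcal S'(\mathbb R^d)$ with $\|f\|_{M^p}:=\|V_gf\|_{L^p(\mathbb R^{2d})}<\infty$, and let $\mathcal M^\infty$ be the closure of $\mathcal S(\mathbb R^d)$ in $M^\infty$, with the norm of $M^\infty$. Then $T$, initially defined on $\mathcal S(\mathbb R^d)$, extends to a bounded linear operator on $M^p$ for every $1\le p<\infty$, and to a bounded linear operator on $\mathcal M^\infty$. -/

import Mathlib

open MeasureTheory SchwartzMap
open scoped ENNReal NNReal ContDiff FourierTransform ComplexConjugate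

noncomputable section

namespace ModulationFIO

/-- `ℝ^d` with its Euclidean norm. -/
abbrev Eu (d : ℕ) : Type := EuclideanSpace ℝ (Fin d)

variable {d : ℕ}

theorem hasTemperateGrowth_cexp_ofReal_mul_I :
    (fun t : ℝ => Complex.exp (t * Complex.I)).HasTemperateGrowth := by
  have hd : ∀ n : ℕ, iteratedDeriv n (fun t : ℝ => Complex.exp (t * Complex.I)) =
      fun t : ℝ => Complex.I ^ n * Complex.exp (t * Complex.I) := by
    intro n
    induction n with
    | zero => simp
    | succ n ih =>
      rw [iteratedDeriv_succ, ih]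
      funext t
      have h : HasDerivAt (fun t : ℝ => Complex.I ^ n * Complex.exp (t * Complex.I))
          (Complex.I ^ n * (Complex.exp (t * Complex.I) * (1 * Complex.I))) t :=
        (((Complex.ofRealCLM.hasDerivAt (x := t)).mul_const Complex.I).cexp).const_mul _
      rw [h.deriv]
      ring
  refine ⟨(Complex.ofRealCLM.contDiff.mul contDiff_const).cexp, fun n => ⟨0, 1, fun t => ?_⟩⟩
  rw [norm_iteratedFDeriv_eq_norm_iteratedDeriv, hd]
  simp [Complex.norm_exp_ofReal_mul_I]

/-- The character `y ↦ e^{2πi η·y}`. -/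
def character (η y : Eu d) : ℂ :=
  Complex.exp (((2 * Real.pi * inner ℝ η y : ℝ) : ℂ) * Complex.I)

theorem hasTemperateGrowth_character (η : Eu d) : (character η).HasTemperateGrowth := by
  have h : (fun y : Eu d => 2 * Real.pi * inner ℝ η y).HasTemperateGrowth :=
    (Function.HasTemperateGrowth.const _).mul
      (Function.hasTemperateGrowth_inner_right η)
  exact hasTemperateGrowth_cexp_ofReal_mul_I.comp h

/-- The time-frequency shift `M_η T_x g`, that is `y ↦ e^{2πi η·y} g(y - x)`. -/
def timeFreqShift (x η : Eu d) (g : 𝓢(Eu d, ℂ)) : 𝓢(Eu d, ℂ) :=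
  SchwartzMap.smulLeftCLM ℂ (character η) (SchwartzMap.compSubConstCLM ℂ x g)

theorem timeFreqShift_apply (x η : Eu d) (g : 𝓢(Eu d, ℂ)) (y : Eu d) :
    timeFreqShift x η g y = character η y * g (y - x) := by
  simp [timeFreqShift, SchwartzMap.smulLeftCLM_apply_apply (hasTemperateGrowth_character η)]

/-- Pointwise complex conjugation on the Schwartz space. -/
def conjSchwartz (g : 𝓢(Eu d, ℂ)) : 𝓢(Eu d, ℂ) :=
  SchwartzMap.postcompCLM (𝕜 := ℝ) (Complex.conjCLE : ℂ →L[ℝ] ℂ) g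

theorem conjSchwartz_apply (g : 𝓢(Eu d, ℂ)) (y : Eu d) :
    conjSchwartz g y = conj (g y) := by
  simp [conjSchwartz]

/-- The short-time Fourier transform `V_g f (x, η) = ⟨f, M_η T_x g⟩` of a tempered distribution
`f`. The pairing is conjugate-linear in its second argument, whereas `f` acts linearly on test
functions, hence the conjugation. -/
def stft (g : 𝓢(Eu d, ℂ)) (f : 𝓢'(Eu d, ℂ)) (z : Eu d × Eu d) : ℂ :=
  f (conjSchwartz (timeFreqShift z.1 z.2 g))

theorem stft_add (g : 𝓢(Eu d, ℂ)) (f₁ f₂ : 𝓢'(Eu d, ℂ)) :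
    stft g (f₁ + f₂) = stft g f₁ + stft g f₂ := rfl

theorem stft_smul (g : 𝓢(Eu d, ℂ)) (c : ℂ) (f : 𝓢'(Eu d, ℂ)) :
    stft g (c • f) = c • stft g f := rfl

theorem stft_zero (g : 𝓢(Eu d, ℂ)) : stft g (0 : 𝓢'(Eu d, ℂ)) = 0 := rfl

/-- The norm `‖f‖_{M^p} = ‖V_g f‖_{L^p(ℝ^{2d})}`, with value `∞` allowed. -/
def modNorm (g : 𝓢(Eu d, ℂ)) (p : ℝ≥0∞) (f : 𝓢'(Eu d, ℂ)) : ℝ≥0∞ :=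
  eLpNorm (stft g f) p volume

/-- The modulation space `M^p(ℝ^d)`, defined with the window `g`. -/
def modSpace (g : 𝓢(Eu d, ℂ)) (p : ℝ≥0∞) : Submodule ℂ 𝓢'(Eu d, ℂ) where
  carrier := {f | MemLp (stft g f) p volume}
  zero_mem' := by
    rw [Set.mem_ofPred_eq, stft_zero]
    exact MemLp.zero
  add_mem' h₁ h₂ := by
    rw [Set.mem_ofPred_eq, stft_add]
    exact MemLp.add h₁ h₂
  smul_mem' c f h := by
    rw [Set.mem_ofPred_eq, stft_smul]
    exact MemLp.const_smul h c

/-- The space `𝓜^∞(ℝ^d)`: the closure of the Schwartz space in the `M^∞`-norm. -/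
def modSpaceInfty (g : 𝓢(Eu d, ℂ)) : Submodule ℂ 𝓢'(Eu d, ℂ) where
  carrier := {f | f ∈ modSpace g ⊤ ∧ ∀ ε : ℝ≥0∞, 0 < ε →
    ∃ u : 𝓢(Eu d, ℂ), (u : 𝓢'(Eu d, ℂ)) ∈ modSpace g ⊤ ∧
      modNorm g ⊤ (f - (u : 𝓢'(Eu d, ℂ))) < ε}
  zero_mem' := by
    refine ⟨Submodule.zero_mem _, fun ε hε => ⟨0, ?_, ?_⟩⟩
    · rw [map_zero]
      exact Submodule.zero_mem _
    · rw [map_zero, sub_zero, modNorm, stft_zero, eLpNorm_zero]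
      exact hε
  add_mem' := by
    rintro f₁ f₂ ⟨h₁, k₁⟩ ⟨h₂, k₂⟩
    refine ⟨Submodule.add_mem _ h₁ h₂, fun ε hε => ?_⟩
    obtain ⟨u₁, m₁, e₁⟩ := k₁ (ε / 2) (ENNReal.half_pos hε.ne')
    obtain ⟨u₂, m₂, e₂⟩ := k₂ (ε / 2) (ENNReal.half_pos hε.ne')
    refine ⟨u₁ + u₂, ?_, ?_⟩
    · rw [map_add]
      exact Submodule.add_mem _ m₁ m₂
    · rw [map_add, add_sub_add_comm, modNorm, stft_add]
      have a₁ : MemLp (stft g (f₁ - (u₁ : 𝓢'(Eu d, ℂ)))) ⊤ volume := Submodule.sub_mem _ h₁ m₁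
      have a₂ : MemLp (stft g (f₂ - (u₂ : 𝓢'(Eu d, ℂ)))) ⊤ volume := Submodule.sub_mem _ h₂ m₂
      calc _ ≤ _ := eLpNorm_add_le a₁.1 a₂.1 le_top
        _ < ε / 2 + ε / 2 := ENNReal.add_lt_add e₁ e₂
        _ = ε := ENNReal.add_halves ε
  smul_mem' := by
    rintro c f ⟨h, k⟩
    refine ⟨Submodule.smul_mem _ c h, fun ε hε => ?_⟩
    by_cases hc : c = 0
    · refine ⟨0, ?_, ?_⟩
      · rw [map_zero]
        exact Submodule.zero_mem _
      · rw [map_zero, sub_zero, hc, zero_smul, modNorm, stft_zero, eLpNorm_zero]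
        exact hε
    · have hc0 : ‖c‖ₑ ≠ 0 := by simpa using hc
      obtain ⟨u, m, e⟩ := k (ε / ‖c‖ₑ) (ENNReal.div_pos hε.ne' enorm_ne_top)
      refine ⟨c • u, ?_, ?_⟩
      · rw [map_smul]
        exact Submodule.smul_mem _ c m
      · rw [map_smul, ← smul_sub, modNorm, stft_smul, eLpNorm_const_smul, mul_comm]
        exact (ENNReal.lt_div_iff_mul_lt (Or.inl hc0) (Or.inl enorm_ne_top)).1 e

/-- The Fourier integral operator with phase `Φ` and symbol `σ`, on Schwartz functions:
`T u (x) = ∫ e^{2πi Φ(x, η)} σ(x, η) û(η) dη`. -/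
def fio (Φ : Eu d → Eu d → ℝ) (σ : Eu d → Eu d → ℂ) (u : 𝓢(Eu d, ℂ)) (x : Eu d) : ℂ :=
  ∫ η : Eu d, Complex.exp (2 * Real.pi * Complex.I * Φ x η) * σ x η * 𝓕 (u : Eu d → ℂ) η

/-- The tempered distribution `F` is given by the function `h`. -/
def IsGivenBy (F : 𝓢'(Eu d, ℂ)) (h : Eu d → ℂ) : Prop :=
  LocallyIntegrable h volume ∧
    ∀ φ : 𝓢(Eu d, ℂ), Integrable (fun x => φ x * h x) volume ∧ F φ = ∫ x, φ x * h x

/-- The operator `T`, initially defined on the Schwartz space with values in functions, extends to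
a bounded operator on the space `M` of tempered distributions (which in particular contains the
Schwartz space) with respect to the norm `N`. -/
def ExtendsToBounded (T : 𝓢(Eu d, ℂ) → Eu d → ℂ) (M : Submodule ℂ 𝓢'(Eu d, ℂ))
    (N : 𝓢'(Eu d, ℂ) → ℝ≥0∞) : Prop :=
  ∃ A : M →ₗ[ℂ] M,
    (∀ u : 𝓢(Eu d, ℂ), ∃ hu : (u : 𝓢'(Eu d, ℂ)) ∈ M,
      IsGivenBy (A ⟨(u : 𝓢'(Eu d, ℂ)), hu⟩ : 𝓢'(Eu d, ℂ)) (T u)) ∧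
    ∃ C : ℝ≥0, ∀ f : M, N (A f : 𝓢'(Eu d, ℂ)) ≤ C * N (f : 𝓢'(Eu d, ℂ))

end ModulationFIO

end

/-! The mechanism is that the low-frequency singularity of the phase can be absorbed into a
convergent dyadic superposition of one Schwartz function. Write `e^{2πiΦ}σ = σ + (e^{2πiΦ} - 1)σ`
and insert a partition `∑ ψ(2^j η) = 1` in the second term. With `E(s) = (e^{2πis} - 1)/s` and
homogeneity, the `j`-th piece is `2^{-j} m(2^{-j}, x, 2^j η)`, where `m(t, x, ζ) = Φ(x, ζ) ψ(ζ)
E(tΦ(x, ζ)) σ(x, tζ)`. Since `ψ` vanishes near the origin, `m` is smooth, also at `t = 0`. After a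
cutoff in `t` it is compactly supported, so the whole kernel comes from a single Schwartz function
`M` of `(t, x, ζ)`, with summable weights `2^{-j}` (`exists_dyadic_representation`).

Fourier inversion of `M` in all its variables turns `Tu(x)` into `X(x) ∫ 𝓕M(e) Λ(e) e^{2πi a·x} de`,
where `e = (τ, a, b)`, `X` is a cutoff equal to `1` on the ball of radius `R`, `Λ(e) = ∑ 2^{-j}
e^{2πi τ 2^{-j}} λ(2^j b)` and `λ(b) = ⟨u, 𝓕X(· - b)⟩` (`superposition_eq_integral`,
`fio_eq_synthesis`). Only the sup norm of `λ` matters. It is controlled by `‖u‖_{M^p}`, because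
translates of a Schwartz function have short-time transforms of constant `L^q` norm, `q` being the
conjugate exponent (`stft_inversion`, `exists_enorm_apply_translate_le`). Conversely, a
superposition of modulations of `X` with rapidly decaying weight is a Schwartz function whose
short-time transform decays rapidly, with a constant linear in `‖λ‖_∞`
(`exists_norm_stft_synthesis_le`).

The formula makes sense for every `f` in `M^p`, `p = ∞` included, so it defines the extension
directly, without a density argument. -/

noncomputable section

namespace ModulationFIO

/-! ### Continuity of translation on the Schwartz space. -/

section Translation

variable {E : Type*} [NormedAddCommGroup E] [NormedSpace ℝ E]

/-- A seminorm dominating `(1 + ‖x‖)^k ‖D^l φ(x)‖`. -/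
def dominatingSeminorm (k l : ℕ) : Seminorm ℝ 𝓢(E, ℂ) :=
  (Finset.Iic (k, l)).sup (schwartzSeminormFamily ℝ E ℂ)

theorem continuous_dominatingSeminorm (k l : ℕ) :
    Continuous (dominatingSeminorm k l : Seminorm ℝ 𝓢(E, ℂ)) :=
  Seminorm.continuous_finsetSup fun i _ => (schwartz_withSeminorms ℝ E ℂ).continuous_seminorm i

theorem weight_mul_norm_iteratedFDeriv_le (k l : ℕ) (φ : 𝓢(E, ℂ)) (x : E) :
    (1 + ‖x‖) ^ k * ‖iteratedFDeriv ℝ l φ x‖ ≤ 2 ^ k * dominatingSeminorm k l φ :=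
  SchwartzMap.one_add_le_sup_seminorm_apply (𝕜 := ℝ) (m := (k, l)) le_rfl le_rfl φ x

theorem iteratedFDeriv_translate (a : E) (φ : 𝓢(E, ℂ)) (l : ℕ) (x : E) :
    iteratedFDeriv ℝ l (compSubConstCLM ℂ a φ) x = iteratedFDeriv ℝ l φ (x - a) := by
  have : (compSubConstCLM ℂ a φ : E → ℂ) = fun y => φ (y - a) := by
    ext y; simp
  rw [this, iteratedFDeriv_comp_sub]

theorem seminorm_translate_le (k l : ℕ) (a : E) (φ : 𝓢(E, ℂ)) :
    SchwartzMap.seminorm ℝ k l (compSubConstCLM ℂ a φ) ≤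
      (1 + ‖a‖) ^ k * (2 ^ k * dominatingSeminorm k l φ) := by
  refine SchwartzMap.seminorm_le_bound ℝ k l _ (by positivity) fun x => ?_
  rw [iteratedFDeriv_translate]
  have h1 : ‖x‖ ≤ (1 + ‖a‖) * (1 + ‖x - a‖) := by
    have := norm_add_le (x - a) a
    rw [sub_add_cancel] at this
    nlinarith [norm_nonneg a, norm_nonneg (x - a)]
  calc ‖x‖ ^ k * ‖iteratedFDeriv ℝ l φ (x - a)‖
      ≤ ((1 + ‖a‖) * (1 + ‖x - a‖)) ^ k * ‖iteratedFDeriv ℝ l φ (x - a)‖ := by gcongr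
    _ = (1 + ‖a‖) ^ k * ((1 + ‖x - a‖) ^ k * ‖iteratedFDeriv ℝ l φ (x - a)‖) := by
        rw [mul_pow, mul_assoc]
    _ ≤ _ := mul_le_mul_of_nonneg_left (weight_mul_norm_iteratedFDeriv_le k l φ _) (by positivity)

/-- Mean value inequality on the segment from `x - b` to `x - a`; this costs one derivative. Points
of the segment stay within `‖a - b‖` of `x - b`, so the weight at `x` is comparable with the weight
along the segment. -/
theorem seminorm_translate_sub_translate_le (k l : ℕ) (a b : E) (φ : 𝓢(E, ℂ)) :
    SchwartzMap.seminorm ℝ k l (compSubConstCLM ℂ a φ - compSubConstCLM ℂ b φ) ≤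
      ‖a - b‖ * ((1 + ‖b‖ + ‖a - b‖) ^ k * (2 ^ k * dominatingSeminorm k (l + 1) φ)) := by
  refine SchwartzMap.seminorm_le_bound ℝ k l _ (by positivity) fun x => ?_
  have hsub : iteratedFDeriv ℝ l (compSubConstCLM ℂ a φ - compSubConstCLM ℂ b φ : 𝓢(E, ℂ)) x =
      iteratedFDeriv ℝ l φ (x - a) - iteratedFDeriv ℝ l φ (x - b) := by
    rw [← iteratedFDeriv_translate, ← iteratedFDeriv_translate]
    rw [← iteratedFDeriv_sub_apply]
    · rfl
    · exact ((compSubConstCLM ℂ a φ).smooth l).contDiffAt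
    · exact ((compSubConstCLM ℂ b φ).smooth l).contDiffAt
  rw [hsub]
  set D := 2 ^ k * dominatingSeminorm k (l + 1) φ with hD
  -- The derivative bound below is divided by the weight, so a vanishing weight is treated apart.
  by_cases hx : ‖x‖ ^ k = 0
  · rw [hx, zero_mul]; positivity
  have hx0 : 0 < ‖x‖ ^ k := lt_of_le_of_ne (by positivity) (Ne.symm hx)
  have key : ∀ y ∈ segment ℝ (x - b) (x - a), ‖fderiv ℝ (iteratedFDeriv ℝ l φ) y‖ ≤
      (1 + ‖b‖ + ‖a - b‖) ^ k * D / ‖x‖ ^ k := by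
    intro y hy
    rw [norm_fderiv_iteratedFDeriv, le_div_iff₀ hx0]
    have hy' : ‖y - (x - b)‖ ≤ ‖a - b‖ := by
      have := norm_sub_le_of_mem_segment hy
      rwa [show x - a - (x - b) = -(a - b) by abel, norm_neg] at this
    have h1 : ‖x‖ ≤ (1 + ‖b‖ + ‖a - b‖) * (1 + ‖y‖) := by
      have h2 : ‖x‖ ≤ ‖y‖ + ‖y - (x - b)‖ + ‖b‖ := by
        calc ‖x‖ = ‖y - (y - (x - b)) + b‖ := by congr 1; abel
          _ ≤ _ := (norm_add_le _ _).trans (by gcongr; exact norm_sub_le _ _)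
      nlinarith [norm_nonneg b, norm_nonneg y, norm_nonneg (a - b)]
    calc ‖iteratedFDeriv ℝ (l + 1) φ y‖ * ‖x‖ ^ k
        ≤ ‖iteratedFDeriv ℝ (l + 1) φ y‖ * ((1 + ‖b‖ + ‖a - b‖) * (1 + ‖y‖)) ^ k := by gcongr
      _ = (1 + ‖b‖ + ‖a - b‖) ^ k * ((1 + ‖y‖) ^ k * ‖iteratedFDeriv ℝ (l + 1) φ y‖) := by
          rw [mul_pow]; ring
      _ ≤ _ := mul_le_mul_of_nonneg_left (weight_mul_norm_iteratedFDeriv_le k (l + 1) φ y)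
          (by positivity)
  have hdiff : ∀ y ∈ segment ℝ (x - b) (x - a),
      DifferentiableAt ℝ (iteratedFDeriv ℝ l φ) y := fun y _ =>
    (φ.smooth (l + 1)).differentiable_iteratedFDeriv (by exact_mod_cast Nat.lt_succ_self l) y
  have := (convex_segment (x - b) (x - a)).norm_image_sub_le_of_norm_fderiv_le (𝕜 := ℝ) hdiff key
    (left_mem_segment _ _ _) (right_mem_segment _ _ _)
  calc _ ≤ ‖x‖ ^ k * ((1 + ‖b‖ + ‖a - b‖) ^ k * D / ‖x‖ ^ k * ‖x - a - (x - b)‖) := by gcongr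
    _ = _ := by
      rw [show x - a - (x - b) = -(a - b) by abel, norm_neg]
      field_simp

/-- Joint continuity is needed because, on the Fourier side of a time-frequency shift, the
translated function itself varies with the phase-space point. -/
theorem continuous_translate :
    Continuous fun q : E × 𝓢(E, ℂ) => compSubConstCLM ℂ q.1 q.2 := by
  rw [continuous_iff_continuousAt]
  rintro ⟨b, ψ⟩
  rw [ContinuousAt, (schwartz_withSeminorms ℝ E ℂ).tendsto_nhds]
  rintro ⟨k, l⟩ ε hε
  set B : E × 𝓢(E, ℂ) → ℝ := fun q =>
    (1 + ‖q.1‖) ^ k * (2 ^ k * dominatingSeminorm k l (q.2 - ψ)) +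
    ‖q.1 - b‖ * ((1 + ‖b‖ + ‖q.1 - b‖) ^ k * (2 ^ k * dominatingSeminorm k (l + 1) ψ)) with hB
  have hBc : Continuous B := by
    have := continuous_dominatingSeminorm (E := E) k l
    fun_prop
  have hB0 : B (b, ψ) = 0 := by simp [hB]
  have : ∀ᶠ q in nhds (b, ψ), B q < ε := by
    have := hBc.tendsto (b, ψ)
    rw [hB0] at this
    exact this.eventually_lt_const hε
  filter_upwards [this] with q hq
  refine lt_of_le_of_lt ?_ hq
  have e : compSubConstCLM ℂ q.1 q.2 - compSubConstCLM ℂ b ψ =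
      compSubConstCLM ℂ q.1 (q.2 - ψ) + (compSubConstCLM ℂ q.1 ψ - compSubConstCLM ℂ b ψ) := by
    rw [map_sub]; abel
  simp only [schwartzSeminormFamily_apply]
  rw [e]
  exact (map_add_le_add _ _ _).trans
    (add_le_add (seminorm_translate_le _ _ _ _) (seminorm_translate_sub_translate_le _ _ _ _ _))

end Translation

/-! ### Families of Schwartz functions with polynomial growth. -/

section PolyBounded

variable {Z E : Type*} [NormedAddCommGroup Z] [NormedAddCommGroup E] [NormedSpace ℝ E]

/-- A family of Schwartz functions all of whose seminorms grow at most polynomially. -/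
def PolyBounded (F : Z → 𝓢(E, ℂ)) : Prop :=
  ∀ k l : ℕ, ∃ (C : ℝ) (N : ℕ), 0 ≤ C ∧
    ∀ z, SchwartzMap.seminorm ℝ k l (F z) ≤ C * (1 + ‖z‖) ^ N

theorem PolyBounded.finset_sup {F : Z → 𝓢(E, ℂ)} (hF : PolyBounded F) (s : Finset (ℕ × ℕ)) :
    ∃ (C : ℝ) (N : ℕ), 0 ≤ C ∧
      ∀ z, s.sup (schwartzSeminormFamily ℝ E ℂ) (F z) ≤ C * (1 + ‖z‖) ^ N := by
  classical
  induction s using Finset.induction_on with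
  | empty => exact ⟨0, 0, le_rfl, fun z => by simp⟩
  | insert i s _ ih =>
    obtain ⟨C₁, N₁, h₁, b₁⟩ := hF i.1 i.2
    obtain ⟨C₂, N₂, h₂, b₂⟩ := ih
    refine ⟨C₁ + C₂, N₁ + N₂, add_nonneg h₁ h₂, fun z => ?_⟩
    have hz : 1 ≤ 1 + ‖z‖ := by linarith [norm_nonneg z]
    rw [Finset.sup_insert, Seminorm.sup_apply, add_mul]
    refine max_le ((b₁ z).trans ?_) ((b₂ z).trans ?_)
    · exact le_add_of_le_of_nonneg (by gcongr; omega) (by positivity)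
    · exact le_add_of_nonneg_of_le (by positivity) (by gcongr; omega)

/-- Each seminorm of the image is dominated by finitely many seminorms of the argument, and a finite
supremum of polynomial bounds is again polynomial. -/
theorem PolyBounded.clm {F : Z → 𝓢(E, ℂ)} (hF : PolyBounded F)
    (L : 𝓢(E, ℂ) →L[ℝ] 𝓢(E, ℂ)) : PolyBounded fun z => L (F z) := by
  intro k l
  have hc : Continuous ((SchwartzMap.seminorm ℝ k l : Seminorm ℝ 𝓢(E, ℂ)).comp L.toLinearMap) :=
    ((schwartz_withSeminorms ℝ E ℂ).continuous_seminorm (k, l)).comp L.continuous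
  obtain ⟨s, D, -, hD⟩ := Seminorm.bound_of_continuous (schwartz_withSeminorms ℝ E ℂ) _ hc
  obtain ⟨C, N, hC, hb⟩ := hF.finset_sup s
  refine ⟨D * C, N, by positivity, fun z => (hD (F z)).trans ?_⟩
  rw [mul_assoc]
  exact mul_le_mul_of_nonneg_left (hb z) D.2

theorem PolyBounded.translate {F : Z → 𝓢(E, ℂ)} (hF : PolyBounded F) {a : Z → E}
    (ha : ∀ z, ‖a z‖ ≤ ‖z‖) : PolyBounded fun z => compSubConstCLM ℂ (a z) (F z) := by
  intro k l
  obtain ⟨C, N, hC, hb⟩ := hF.finset_sup (Finset.Iic (k, l))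
  refine ⟨2 ^ k * C, k + N, by positivity, fun z => (seminorm_translate_le k l _ _).trans ?_⟩
  calc (1 + ‖a z‖) ^ k * (2 ^ k * dominatingSeminorm k l (F z))
      ≤ (1 + ‖z‖) ^ k * (2 ^ k * (C * (1 + ‖z‖) ^ N)) := by
        gcongr
        · exact ha z
        · exact hb z
    _ = _ := by ring

theorem PolyBounded.const (φ : 𝓢(E, ℂ)) : PolyBounded fun _ : Z => φ := fun k l =>
  ⟨SchwartzMap.seminorm ℝ k l φ, 0, apply_nonneg _ _, fun z => by simp⟩

end PolyBounded

variable {d : ℕ}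

/-! ### Characters and time-frequency shifts. -/

theorem norm_character (η y : Eu d) : ‖character η y‖ = 1 := by
  rw [character, Complex.norm_exp_ofReal_mul_I]

theorem character_eq_fourierChar (η y : Eu d) :
    character η y = (Real.fourierChar (inner ℝ y η) : ℂ) := by
  rw [character, Real.fourierChar_apply, real_inner_comm]

theorem character_comm (η y : Eu d) : character η y = character y η := by
  rw [character, character, real_inner_comm]

theorem character_add_left (η ξ y : Eu d) :
    character (η + ξ) y = character η y * character ξ y := by
  rw [character, character, character, ← Complex.exp_add, inner_add_left]
  push_cast; ring_nf

theorem character_add_right (η x y : Eu d) :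
    character η (x + y) = character η x * character η y := by
  rw [character_comm, character_add_left, character_comm, character_comm y]

theorem character_neg_left (η y : Eu d) : character (-η) y = conj (character η y) := by
  rw [character, character, ← Complex.exp_conj, inner_neg_left, map_mul, Complex.conj_ofReal,
    Complex.conj_I]
  push_cast; ring_nf

theorem character_sub_left (η ξ y : Eu d) :
    character (η - ξ) y = character η y * conj (character ξ y) := by
  rw [sub_eq_add_neg, character_add_left, character_neg_left]

@[fun_prop]
theorem continuous_character : Continuous fun q : Eu d × Eu d => character q.1 q.2 := by
  unfold character
  fun_prop

theorem fourier_eq_integral_character (f : Eu d → ℂ) (ξ : Eu d) :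
    𝓕 f ξ = ∫ y, conj (character ξ y) * f y := by
  rw [Real.fourier_eq]
  refine integral_congr_ae (.of_forall fun y => ?_)
  simp only [character_eq_fourierChar, Circle.smul_def, smul_eq_mul, AddChar.map_neg_eq_inv,
    Circle.coe_inv_eq_conj]

theorem fourierInv_eq_integral_character (f : Eu d → ℂ) (ξ : Eu d) :
    𝓕⁻ f ξ = ∫ y, character ξ y * f y := by
  rw [Real.fourierInv_eq]
  refine integral_congr_ae (.of_forall fun y => ?_)
  simp only [character_eq_fourierChar, Circle.smul_def, smul_eq_mul]

theorem fourier_modulate (η : Eu d) (φ : 𝓢(Eu d, ℂ)) :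
    𝓕 (SchwartzMap.smulLeftCLM ℂ (character η) φ) = compSubConstCLM ℂ η (𝓕 φ) := by
  ext ξ
  rw [compSubConstCLM_apply, fourier_coe, fourier_coe, fourier_eq_integral_character,
    fourier_eq_integral_character]
  refine integral_congr_ae (.of_forall fun y => ?_)
  simp only [SchwartzMap.smulLeftCLM_apply_apply (hasTemperateGrowth_character η), smul_eq_mul,
    character_sub_left, map_mul, Complex.conj_conj]
  ring

/-- Modulation is translation on the Fourier side. Continuity and polynomial growth of
time-frequency shifts thereby reduce to those of translation, the Fourier transform being
continuous. -/
theorem timeFreqShift_eq_fourierInv (x η : Eu d) (g : 𝓢(Eu d, ℂ)) :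
    timeFreqShift x η g = 𝓕⁻ (compSubConstCLM ℂ η (𝓕 (compSubConstCLM ℂ x g))) := by
  rw [timeFreqShift, ← fourier_modulate, FourierTransform.fourierInv_fourier_eq]

theorem continuous_timeFreqShift (g : 𝓢(Eu d, ℂ)) :
    Continuous fun z : Eu d × Eu d => timeFreqShift z.1 z.2 g := by
  simp only [timeFreqShift_eq_fourierInv]
  have h1 : Continuous fun z : Eu d × Eu d => compSubConstCLM ℂ z.1 g :=
    continuous_translate.comp (continuous_fst.prodMk continuous_const)
  have h2 : Continuous fun z : Eu d × Eu d => 𝓕 (compSubConstCLM ℂ z.1 g) :=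
    (FourierTransform.fourierCLM ℂ 𝓢(Eu d, ℂ)).continuous.comp h1
  have h3 := continuous_translate.comp (continuous_snd.prodMk h2)
  exact (FourierTransform.fourierInvCLM ℂ 𝓢(Eu d, ℂ)).continuous.comp h3

theorem polyBounded_timeFreqShift (g : 𝓢(Eu d, ℂ)) :
    PolyBounded fun z : Eu d × Eu d => timeFreqShift z.1 z.2 g := by
  simp only [timeFreqShift_eq_fourierInv]
  have h1 : PolyBounded fun z : Eu d × Eu d => compSubConstCLM ℂ z.1 g :=
    (PolyBounded.const g).translate fun z => norm_fst_le z
  have h2 := h1.clm ((FourierTransform.fourierCLM ℂ 𝓢(Eu d, ℂ)).restrictScalars ℝ)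
  have h3 := h2.translate (a := fun z => z.2) fun z => norm_snd_le z
  exact h3.clm ((FourierTransform.fourierInvCLM ℂ 𝓢(Eu d, ℂ)).restrictScalars ℝ)

theorem continuous_conjSchwartz : Continuous (conjSchwartz : 𝓢(Eu d, ℂ) → 𝓢(Eu d, ℂ)) :=
  (SchwartzMap.postcompCLM (𝕜 := ℝ) (Complex.conjCLE : ℂ →L[ℝ] ℂ)).continuous

theorem continuous_conj_timeFreqShift (g : 𝓢(Eu d, ℂ)) :
    Continuous fun z : Eu d × Eu d => conjSchwartz (timeFreqShift z.1 z.2 g) :=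
  continuous_conjSchwartz.comp (continuous_timeFreqShift g)

theorem polyBounded_conj_timeFreqShift (g : 𝓢(Eu d, ℂ)) :
    PolyBounded fun z : Eu d × Eu d => conjSchwartz (timeFreqShift z.1 z.2 g) :=
  (polyBounded_timeFreqShift g).clm
    (SchwartzMap.postcompCLM (𝕜 := ℝ) (Complex.conjCLE : ℂ →L[ℝ] ℂ))

theorem continuous_stft (g : 𝓢(Eu d, ℂ)) (f : 𝓢'(Eu d, ℂ)) : Continuous (stft g f) :=
  (map_continuous f).comp (continuous_conj_timeFreqShift g)

/-! ### Exchanging tempered distributions with integrals of Schwartz functions. -/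

section Interchange

variable {E : Type*} [NormedAddCommGroup E] [NormedSpace ℝ E]

/-- Bounded continuous functions with values in `l`-linear forms. -/
def BoundedForms (E : Type*) [NormedAddCommGroup E] [NormedSpace ℝ E] (l : ℕ) : Type _ :=
  @BoundedContinuousFunction E (ContinuousMultilinearMap ℝ (fun _ : Fin l => E) ℂ) _
    SeminormedAddCommGroup.toPseudoMetricSpace

instance (l : ℕ) : NormedAddCommGroup (BoundedForms E l) :=
  inferInstanceAs (NormedAddCommGroup (@BoundedContinuousFunction E
    (ContinuousMultilinearMap ℝ (fun _ : Fin l => E) ℂ) _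
    SeminormedAddCommGroup.toPseudoMetricSpace))

instance (l : ℕ) : NormedSpace ℂ (BoundedForms E l) :=
  inferInstanceAs (NormedSpace ℂ (@BoundedContinuousFunction E
    (ContinuousMultilinearMap ℝ (fun _ : Fin l => E) ℂ) _
    SeminormedAddCommGroup.toPseudoMetricSpace))

instance (l : ℕ) : CompleteSpace (BoundedForms E l) :=
  inferInstanceAs (CompleteSpace (@BoundedContinuousFunction E
    (ContinuousMultilinearMap ℝ (fun _ : Fin l => E) ℂ) _
    SeminormedAddCommGroup.toPseudoMetricSpace))

/-- The function underlying an element of `BoundedForms`. -/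
def BoundedForms.toBCF {l : ℕ} (u : BoundedForms E l) : @BoundedContinuousFunction E
    (ContinuousMultilinearMap ℝ (fun _ : Fin l => E) ℂ) _
    SeminormedAddCommGroup.toPseudoMetricSpace := u

/-- Evaluation of a bounded function at a point. -/
def BoundedForms.eval {l : ℕ} (y : E) :
    BoundedForms E l →L[ℂ] ContinuousMultilinearMap ℝ (fun _ : Fin l => E) ℂ :=
  LinearMap.mkContinuous
    { toFun := fun u => u.toBCF y
      map_add' := fun _ _ => rfl
      map_smul' := fun _ _ => rfl } 1 fun u => by
    rw [one_mul]
    exact BoundedContinuousFunction.norm_coe_le_norm u.toBCF y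

theorem BoundedForms.ext {l : ℕ} {u v : BoundedForms E l}
    (h : ∀ y, BoundedForms.eval y u = BoundedForms.eval y v) : u = v :=
  BoundedContinuousFunction.ext h

theorem BoundedForms.norm_le {l : ℕ} {u : BoundedForms E l} {C : ℝ} (hC : 0 ≤ C) :
    ‖u‖ ≤ C ↔ ∀ y, ‖BoundedForms.eval y u‖ ≤ C :=
  BoundedContinuousFunction.norm_le (f := u.toBCF) hC

/-- The bounded continuous function `x ↦ ‖x‖^k D^l φ(x)`. -/
def weightedDeriv (k l : ℕ) :
    𝓢(E, ℂ) →ₗ[ℂ] BoundedForms E l where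
  toFun φ := BoundedContinuousFunction.ofNormedAddCommGroup
    (fun x => (‖x‖ ^ k : ℝ) • iteratedFDeriv ℝ l φ x)
    ((continuous_norm.pow k).smul ((φ.smooth l).continuous_iteratedFDeriv le_rfl))
    (SchwartzMap.seminorm ℝ k l φ) (fun x => by
      rw [norm_smul, norm_pow, norm_norm]
      exact SchwartzMap.le_seminorm ℝ k l φ x)
  map_add' φ ψ := by
    refine BoundedForms.ext fun x => ?_
    have : iteratedFDeriv ℝ l (φ + ψ : 𝓢(E, ℂ)) x =
        iteratedFDeriv ℝ l φ x + iteratedFDeriv ℝ l ψ x :=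
      iteratedFDeriv_add_apply (φ.smooth l).contDiffAt (ψ.smooth l).contDiffAt
    exact (congrArg (fun v => (‖x‖ ^ k : ℝ) • v) this).trans (smul_add (‖x‖ ^ k : ℝ) _ _)
  map_smul' c φ := by
    refine BoundedForms.ext fun x => ?_
    have : iteratedFDeriv ℝ l (c • φ : 𝓢(E, ℂ)) x = c • iteratedFDeriv ℝ l φ x :=
      iteratedFDeriv_const_smul_apply (φ.smooth l).contDiffAt
    exact (congrArg (fun v => (‖x‖ ^ k : ℝ) • v) this).trans (smul_comm (‖x‖ ^ k : ℝ) c _)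

theorem eval_weightedDeriv (k l : ℕ) (φ : 𝓢(E, ℂ)) (x : E) :
    BoundedForms.eval x (weightedDeriv k l φ) = (‖x‖ ^ k : ℝ) • iteratedFDeriv ℝ l φ x := rfl

theorem norm_weightedDeriv (k l : ℕ) (φ : 𝓢(E, ℂ)) :
    ‖weightedDeriv k l φ‖ = SchwartzMap.seminorm ℂ k l φ := by
  apply le_antisymm
  · refine (BoundedForms.norm_le (apply_nonneg _ _)).2 fun x => ?_
    rw [eval_weightedDeriv, norm_smul, norm_pow, norm_norm]
    exact SchwartzMap.le_seminorm ℂ k l φ x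
  · refine SchwartzMap.seminorm_le_bound ℂ k l _ (norm_nonneg _) fun x => ?_
    have := (BoundedForms.norm_le (norm_nonneg _)).1 (le_refl ‖weightedDeriv k l φ‖) x
    rwa [eval_weightedDeriv, norm_smul, norm_pow, norm_norm] at this

theorem seminorm_complex_eq_real (k l : ℕ) (φ : 𝓢(E, ℂ)) :
    SchwartzMap.seminorm ℂ k l φ = SchwartzMap.seminorm ℝ k l φ := by
  rw [SchwartzMap.seminorm_apply, SchwartzMap.seminorm_apply]

/-- Finitely many weighted derivatives, as an element of a Banach space. -/
def weightedDerivs (s : Finset (ℕ × ℕ)) :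
    𝓢(E, ℂ) →ₗ[ℂ] ((i : s) → BoundedForms E i.1.2) :=
  LinearMap.pi fun i => weightedDeriv i.1.1 i.1.2

theorem finset_sup_le_norm_weightedDerivs (s : Finset (ℕ × ℕ)) (φ : 𝓢(E, ℂ)) :
    s.sup (schwartzSeminormFamily ℂ E ℂ) φ ≤ ‖weightedDerivs s φ‖ := by
  refine Seminorm.finset_sup_apply_le (norm_nonneg _) fun i hi => ?_
  refine le_trans (le_of_eq ?_) (norm_le_pi_norm (weightedDerivs s φ) ⟨i, hi⟩)
  exact (norm_weightedDeriv i.1 i.2 φ).symm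

theorem continuous_weightedDeriv (k l : ℕ) :
    Continuous (weightedDeriv k l : 𝓢(E, ℂ) →ₗ[ℂ] _) := by
  refine WithSeminorms.continuous_normedSpace_rng _ (schwartz_withSeminorms ℂ E ℂ) _
    ⟨{(k, l)}, 1, fun φ => ?_⟩
  simpa using (norm_weightedDeriv k l φ).le

/-- A tempered distribution factors through finitely many weighted derivatives. -/
theorem exists_factor_weightedDerivs (T : 𝓢(E, ℂ) →L[ℂ] ℂ) :
    ∃ (s : Finset (ℕ × ℕ)) (L : ((i : s) → BoundedForms E i.1.2) →L[ℂ] ℂ),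
      ∀ φ, T φ = L (weightedDerivs s φ) := by
  have hc : Continuous ((normSeminorm ℂ ℂ).comp T.toLinearMap) :=
    continuous_norm.comp T.continuous
  obtain ⟨s, D, -, hD⟩ := Seminorm.bound_of_continuous (schwartz_withSeminorms ℂ E ℂ) _ hc
  have hT : ∀ φ, ‖T φ‖ ≤ D * ‖weightedDerivs s φ‖ := fun φ =>
    (hD φ).trans (mul_le_mul_of_nonneg_left (finset_sup_le_norm_weightedDerivs s φ) D.2)
  set J := weightedDerivs (E := E) s
  -- A merely algebraic section suffices: `T ∘ r` is bounded on the range of `J` by `hT`, and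
  -- Hahn–Banach then extends it.
  obtain ⟨r, hr⟩ := J.rangeRestrict.exists_rightInverse_of_surjective J.range_rangeRestrict
  have hr' : ∀ v : J.range, J (r v) = v := fun v => congrArg Subtype.val (LinearMap.congr_fun hr v)
  let L₀ : J.range →L[ℂ] ℂ := (T.toLinearMap ∘ₗ r).mkContinuous D fun v => by
    have := hT (r v)
    rwa [hr'] at this
  obtain ⟨L, hL, -⟩ := exists_extension_norm_eq J.range L₀
  refine ⟨s, L, fun φ => ?_⟩
  have h1 : L (J φ) = T (r ⟨J φ, φ, rfl⟩) := hL ⟨J φ, φ, rfl⟩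
  -- The chosen preimage of `J φ` need not be `φ`, but the two differ by an element of the kernel of
  -- `J`, on which `T` vanishes by `hT`.
  rw [h1, ← sub_eq_zero, ← map_sub, ← norm_le_zero_iff]
  refine (hT _).trans ?_
  rw [map_sub, hr', sub_self, norm_zero, mul_zero]

theorem continuous_iteratedFDeriv_eval {Z : Type*} [TopologicalSpace Z]
    {F : Z → 𝓢(E, ℂ)} (hF : Continuous F) (l : ℕ) (y : E) :
    Continuous fun z => iteratedFDeriv ℝ l (F z) y := by
  have h := (continuous_weightedDeriv (E := E) 0 l).comp hF
  have := (BoundedForms.eval y).continuous.comp h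
  refine this.congr fun z => ?_
  simp [eval_weightedDeriv]

theorem hasDerivAt_iteratedFDeriv_line (ψ : 𝓢(E, ℂ)) (l : ℕ) (y : E) (m : Fin (l + 1) → E)
    (t : ℝ) :
    HasDerivAt (fun t : ℝ => iteratedFDeriv ℝ l ψ (y + t • m 0) (Fin.tail m))
      (iteratedFDeriv ℝ (l + 1) ψ (y + t • m 0) m) t := by
  have h1 : HasFDerivAt (iteratedFDeriv ℝ l ψ)
      (fderiv ℝ (iteratedFDeriv ℝ l ψ) (y + t • m 0)) (y + t • m 0) :=
    ((ψ.smooth (l + 1)).differentiable_iteratedFDeriv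
      (by exact_mod_cast Nat.lt_succ_self l) _).hasFDerivAt
  have h2 : HasDerivAt (fun t : ℝ => y + t • m 0) (m 0) t := by
    simpa using ((hasDerivAt_id t).smul_const (m 0)).const_add y
  have h3 := h1.comp_hasDerivAt t h2
  have h4 := (ContinuousMultilinearMap.apply ℝ (fun _ : Fin l => E) ℂ
    (Fin.tail m)).hasFDerivAt.comp_hasDerivAt t h3
  rw [iteratedFDeriv_succ_apply_left]
  exact h4

variable {Z : Type*} [TopologicalSpace Z] [SecondCountableTopology Z] [MeasurableSpace Z]
  [OpensMeasurableSpace Z] {ν : Measure Z}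

/-- Differentiation under the integral sign for continuous families of Schwartz functions. -/
theorem iteratedFDeriv_eq_integral {F : Z → 𝓢(E, ℂ)} (hF : Continuous F)
    (hFint : ∀ l, Integrable (fun z => SchwartzMap.seminorm ℝ 0 l (F z)) ν)
    {φ : 𝓢(E, ℂ)} (hφ : ∀ y, φ y = ∫ z, F z y ∂ν) (l : ℕ) (y : E) :
    iteratedFDeriv ℝ l φ y = ∫ z, iteratedFDeriv ℝ l (F z) y ∂ν := by
  have hI : ∀ l y, Integrable (fun z => iteratedFDeriv ℝ l (F z) y) ν := fun l y =>
    (hFint l).mono' (continuous_iteratedFDeriv_eval hF l y).aestronglyMeasurable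
      (.of_forall fun z => SchwartzMap.norm_iteratedFDeriv_le_seminorm ℝ (F z) l y)
  induction l generalizing y with
  | zero =>
    ext m
    rw [ContinuousMultilinearMap.integral_apply (hI 0 y)]
    simpa using hφ y
  | succ l ih =>
    ext m
    rw [ContinuousMultilinearMap.integral_apply (hI (l + 1) y)]
    have hbound : ∀ z x, ‖iteratedFDeriv ℝ (l + 1) (F z) x m‖ ≤
        SchwartzMap.seminorm ℝ 0 (l + 1) (F z) * ∏ i, ‖m i‖ := fun z x =>
      (ContinuousMultilinearMap.le_opNorm _ m).trans (mul_le_mul_of_nonneg_right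
        (SchwartzMap.norm_iteratedFDeriv_le_seminorm ℝ (F z) (l + 1) x) (by positivity))
    have hev : ∀ l y (v : Fin l → E), Continuous fun z => iteratedFDeriv ℝ l (F z) y v :=
      fun l y v => (ContinuousMultilinearMap.apply ℝ (fun _ : Fin l => E) ℂ v).continuous.comp
        (continuous_iteratedFDeriv_eval hF l y)
    -- One more derivative is gained by differentiating at `t = 0` along the line through `y` in the
    -- direction `m 0`; the seminorms of order zero in the weight dominate uniformly in `t`.
    have key := (hasDerivAt_integral_of_dominated_loc_of_deriv_le (μ := ν) (s := Set.univ)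
      (F := fun (t : ℝ) z => iteratedFDeriv ℝ l (F z) (y + t • m 0) (Fin.tail m))
      (F' := fun (t : ℝ) z => iteratedFDeriv ℝ (l + 1) (F z) (y + t • m 0) m) (x₀ := 0)
      (bound := fun z => SchwartzMap.seminorm ℝ 0 (l + 1) (F z) * ∏ i, ‖m i‖)
      Filter.univ_mem
      (.of_forall fun t => (hev l _ _).aestronglyMeasurable)
      (((ContinuousMultilinearMap.apply ℝ (fun _ : Fin l => E) ℂ
        (Fin.tail m)).integrable_comp (hI l _)))
      (hev (l + 1) _ m).aestronglyMeasurable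
      (.of_forall fun z t _ => hbound z _) ((hFint (l + 1)).mul_const _)
      (.of_forall fun z t _ => hasDerivAt_iteratedFDeriv_line (F z) l y m t)).2
    have hφ' := hasDerivAt_iteratedFDeriv_line φ l y m 0
    have hfun : (fun t : ℝ => iteratedFDeriv ℝ l φ (y + t • m 0) (Fin.tail m)) =
        fun t : ℝ => ∫ z, iteratedFDeriv ℝ l (F z) (y + t • m 0) (Fin.tail m) ∂ν := by
      funext t
      rw [ih, ContinuousMultilinearMap.integral_apply (hI l _)]
    rw [hfun] at hφ'
    simpa using hφ'.unique key

/-- Tempered distributions commute with integrals of Schwartz functions. -/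
theorem map_integral_schwartz {F : Z → 𝓢(E, ℂ)} (hF : Continuous F)
    (hFint : ∀ k l, Integrable (fun z => SchwartzMap.seminorm ℝ k l (F z)) ν)
    {φ : 𝓢(E, ℂ)} (hφ : ∀ y, φ y = ∫ z, F z y ∂ν) (T : 𝓢(E, ℂ) →L[ℂ] ℂ) :
    T φ = ∫ z, T (F z) ∂ν := by
  obtain ⟨s, L, hL⟩ := exists_factor_weightedDerivs T
  have hJc : ∀ i : s, Integrable (fun z => weightedDeriv i.1.1 i.1.2 (F z)) ν := fun i =>
    (hFint i.1.1 i.1.2).mono' ((continuous_weightedDeriv _ _).comp hF).aestronglyMeasurable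
      (.of_forall fun z => ((norm_weightedDeriv _ _ _).trans (seminorm_complex_eq_real _ _ _)).le)
  have hJ : Integrable (fun z => weightedDerivs s (F z)) ν := Integrable.of_eval hJc
  simp_rw [hL]
  rw [L.integral_comp_comm hJ]
  -- The weighted derivatives now live in a Banach space, so equality with the Bochner integral can
  -- be tested after evaluation at each point.
  congr 1
  funext i
  have h0 := (ContinuousLinearMap.proj (R := ℂ) (φ := fun i : s => BoundedForms E i.1.2)
    i).integral_comp_comm hJ
  refine BoundedForms.ext fun y => ?_
  have h1 := (BoundedForms.eval y).integral_comp_comm (hJc i)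
  refine Eq.trans ?_ (h1.trans (congrArg _ h0))
  simp only [eval_weightedDeriv]
  rw [integral_smul, ← iteratedFDeriv_eq_integral hF (hFint 0) hφ]
  rfl

end Interchange

/-! ### Polynomial decay weights. -/

section Weight

variable {V : Type*} [NormedAddCommGroup V]

/-- The weight `(1 + ‖z‖)^{-N}`. -/
def decayWeight (N : ℕ) (z : V) : ℝ := ((1 + ‖z‖) ^ N)⁻¹

theorem decayWeight_nonneg (N : ℕ) (z : V) : 0 ≤ decayWeight N z := by
  unfold decayWeight; positivity

theorem decayWeight_le_one (N : ℕ) (z : V) : decayWeight N z ≤ 1 :=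
  inv_le_one_of_one_le₀ (one_le_pow₀ (by linarith [norm_nonneg z]))

theorem continuous_decayWeight (N : ℕ) : Continuous (decayWeight N : V → ℝ) := by
  unfold decayWeight
  exact Continuous.inv₀ (by fun_prop) fun z => by positivity

variable [NormedSpace ℝ V] [FiniteDimensional ℝ V] [MeasurableSpace V] [BorelSpace V]

theorem integrable_decayWeight {N : ℕ} (hN : Module.finrank ℝ V < N) (μ : Measure V)
    [μ.IsAddHaarMeasure] : Integrable (decayWeight N : V → ℝ) μ := by
  have := integrable_one_add_norm (E := V) (μ := μ) (r := N) (by exact_mod_cast hN)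
  refine this.congr (.of_forall fun z => ?_)
  simp only [decayWeight]
  rw [Real.rpow_neg (by positivity), Real.rpow_natCast]

theorem memLp_decayWeight {N : ℕ} (hN : Module.finrank ℝ V < N) (μ : Measure V)
    [μ.IsAddHaarMeasure] {p : ℝ≥0∞} (hp : 1 ≤ p) : MemLp (decayWeight N : V → ℝ) p μ := by
  have hm : AEStronglyMeasurable (decayWeight N : V → ℝ) μ :=
    (continuous_decayWeight N).aestronglyMeasurable
  have hn : ∀ z : V, ‖decayWeight N z‖ = decayWeight N z := fun z =>
    Real.norm_of_nonneg (decayWeight_nonneg N z)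
  by_cases hpt : p = ⊤
  · subst hpt
    exact memLp_top_of_bound hm 1 (.of_forall fun z => (hn z).le.trans (decayWeight_le_one N z))
  have hp0 : p ≠ 0 := (zero_lt_one.trans_le hp).ne'
  rw [← integrable_norm_rpow_iff hm hp0 hpt]
  refine (integrable_decayWeight hN μ).mono'
    ((continuous_decayWeight N).norm.rpow_const fun z =>
      Or.inr ENNReal.toReal_nonneg).aestronglyMeasurable (.of_forall fun z => ?_)
  rw [hn, Real.norm_of_nonneg (Real.rpow_nonneg (decayWeight_nonneg N z) _)]
  refine (Real.rpow_le_rpow_of_exponent_ge' (decayWeight_nonneg N z) (decayWeight_le_one N z)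
    zero_le_one ?_).trans_eq (Real.rpow_one _)
  exact (ENNReal.ofReal_le_iff_le_toReal hpt).1 (by simpa using hp)

end Weight

/-! ### Rapid decay and inversion of the short-time Fourier transform. -/

/-- The bilinear pairing `∫ (M_η T_x g) φ`. -/
def coeff (g φ : 𝓢(Eu d, ℂ)) (z : Eu d × Eu d) : ℂ :=
  ∫ y, timeFreqShift z.1 z.2 g y * φ y

theorem continuous_coeff (g φ : 𝓢(Eu d, ℂ)) : Continuous (coeff g φ) := by
  have := (map_continuous (φ : 𝓢'(Eu d, ℂ))).comp (continuous_timeFreqShift g)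
  refine this.congr fun z => ?_
  rw [Function.comp_apply, coe_apply]
  rfl

theorem stft_coe (g φ : 𝓢(Eu d, ℂ)) (z : Eu d × Eu d) :
    stft g (φ : 𝓢'(Eu d, ℂ)) z = conj (coeff g (conjSchwartz φ) z) := by
  rw [stft, coe_apply, coeff, ← integral_conj]
  refine integral_congr_ae (.of_forall fun y => ?_)
  simp [conjSchwartz_apply]

theorem exists_bound_weighted_norm (g : 𝓢(Eu d, ℂ)) (N : ℕ) :
    ∃ C, 0 ≤ C ∧ ∀ y, (1 + ‖y‖) ^ N * ‖g y‖ ≤ C := by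
  refine ⟨2 ^ N * dominatingSeminorm N 0 g, by positivity, fun y => ?_⟩
  simpa using weight_mul_norm_iteratedFDeriv_le N 0 g y

theorem integrable_weighted_norm {V : Type*} [NormedAddCommGroup V] [NormedSpace ℝ V]
    [FiniteDimensional ℝ V] [MeasurableSpace V] [BorelSpace V] (μ : Measure V)
    [μ.IsAddHaarMeasure] (φ : 𝓢(V, ℂ)) (N : ℕ) :
    Integrable (fun y => (1 + ‖y‖) ^ N * ‖φ y‖) μ := by
  -- The additional `n` powers, one more than the dimension, make the remaining weight integrable.
  set n := Module.finrank ℝ V + 1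
  refine ((integrable_decayWeight (N := n) (Nat.lt_succ_self _) μ).const_mul
    (2 ^ (N + n) * dominatingSeminorm (N + n) 0 φ)).mono'
    (by fun_prop) (.of_forall fun y => ?_)
  have h := weight_mul_norm_iteratedFDeriv_le (N + n) 0 φ y
  rw [norm_iteratedFDeriv_zero, pow_add] at h
  rw [Real.norm_of_nonneg (by positivity), decayWeight, ← div_eq_mul_inv,
    le_div_iff₀ (by positivity)]
  linarith

/-- The inequality `1 + ‖x‖ ≤ (1 + ‖y - x‖)(1 + ‖y‖)` distributes the weight over the two rapidly
decaying factors. Only absolute values enter, so the bound serves both in space and in frequency. -/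
theorem exists_bound_integral_translate (g φ : 𝓢(Eu d, ℂ)) (N : ℕ) :
    ∃ C, 0 ≤ C ∧ ∀ (x : Eu d) (h : Eu d → ℂ), (∀ y, ‖h y‖ ≤ ‖g (y - x)‖ * ‖φ y‖) →
      (1 + ‖x‖) ^ N * ‖∫ y, h y‖ ≤ C := by
  obtain ⟨A, hA, hg⟩ := exists_bound_weighted_norm g N
  have hI := (integrable_weighted_norm volume φ N).const_mul A
  refine ⟨∫ y, A * ((1 + ‖y‖) ^ N * ‖φ y‖), integral_nonneg fun y => by positivity,
    fun x h hh => ?_⟩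
  rw [← Real.norm_of_nonneg (show 0 ≤ (1 + ‖x‖) ^ N by positivity), ← norm_smul,
    ← integral_smul]
  refine norm_integral_le_of_norm_le hI (.of_forall fun y => ?_)
  rw [norm_smul, Real.norm_of_nonneg (by positivity)]
  have hx : 1 + ‖x‖ ≤ (1 + ‖y - x‖) * (1 + ‖y‖) := by
    have : ‖x‖ ≤ ‖y - x‖ + ‖y‖ := by
      calc ‖x‖ = ‖y - (y - x)‖ := by congr 1; abel
        _ ≤ _ := by rw [add_comm]; exact norm_sub_le _ _
    nlinarith [norm_nonneg (y - x), norm_nonneg y]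
  calc (1 + ‖x‖) ^ N * ‖h y‖
      ≤ ((1 + ‖y - x‖) * (1 + ‖y‖)) ^ N * (‖g (y - x)‖ * ‖φ y‖) := by
        gcongr
        exact hh y
    _ = ((1 + ‖y - x‖) ^ N * ‖g (y - x)‖) * ((1 + ‖y‖) ^ N * ‖φ y‖) := by
        rw [mul_pow]; ring
    _ ≤ _ := by gcongr; exact hg _

theorem norm_fourier_translate (x ξ : Eu d) (g : 𝓢(Eu d, ℂ)) :
    ‖𝓕 (compSubConstCLM ℂ x g) ξ‖ = ‖𝓕 g ξ‖ := by
  have : 𝓕 (compSubConstCLM ℂ x g) ξ = conj (character ξ x) * 𝓕 g ξ := by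
    rw [fourier_coe, fourier_coe, fourier_eq_integral_character, fourier_eq_integral_character,
      ← integral_const_mul, ← integral_add_right_eq_self _ x]
    refine integral_congr_ae (.of_forall fun y => ?_)
    simp only [compSubConstCLM_apply, character_add_right, map_mul, add_sub_cancel_right]
    ring
  rw [this, norm_mul, RCLike.norm_conj, norm_character, one_mul]

/-- The pairing of a Schwartz function with time-frequency shifts of a Schwartz function decays
rapidly in phase space. -/
theorem exists_norm_coeff_le (g φ : 𝓢(Eu d, ℂ)) (N : ℕ) :
    ∃ C, 0 ≤ C ∧ ∀ z, ‖coeff g φ z‖ ≤ C * decayWeight N z := by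
  obtain ⟨A, hA, h1⟩ := exists_bound_integral_translate g φ N
  obtain ⟨B, hB, h2⟩ := exists_bound_integral_translate (𝓕 g) (𝓕⁻ φ) N
  refine ⟨max A B, le_max_of_le_left hA, fun z => ?_⟩
  have k1 : (1 + ‖z.1‖) ^ N * ‖coeff g φ z‖ ≤ A := by
    refine h1 z.1 _ fun y => ?_
    rw [norm_mul, timeFreqShift_apply, norm_mul, norm_character, one_mul]
  have k2 : (1 + ‖z.2‖) ^ N * ‖coeff g φ z‖ ≤ B := by
    -- Decay in `η`: on the Fourier side `η` is a translation, while `x` only contributes a phase.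
    have e : coeff g φ z = ∫ ξ, 𝓕 (timeFreqShift z.1 z.2 g) ξ * (𝓕⁻ φ) ξ := by
      rw [integral_fourier_mul_eq, FourierTransform.fourier_fourierInv_eq, coeff]
    rw [e]
    refine h2 z.2 _ fun ξ => ?_
    rw [norm_mul, timeFreqShift, fourier_modulate, compSubConstCLM_apply, norm_fourier_translate]
  rw [decayWeight, ← div_eq_mul_inv, le_div_iff₀ (by positivity), mul_comm]
  rcases max_choice ‖z.1‖ ‖z.2‖ with h | h
  · rw [Prod.norm_def, h]
    exact k1.trans (le_max_left _ _)
  · rw [Prod.norm_def, h]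
    exact k2.trans (le_max_right _ _)

theorem exists_norm_stft_coe_le (g φ : 𝓢(Eu d, ℂ)) (N : ℕ) :
    ∃ C, 0 ≤ C ∧ ∀ z, ‖stft g (φ : 𝓢'(Eu d, ℂ)) z‖ ≤ C * decayWeight N z := by
  obtain ⟨C, hC, h⟩ := exists_norm_coeff_le g (conjSchwartz φ) N
  refine ⟨C, hC, fun z => ?_⟩
  rw [stft_coe, RCLike.norm_conj]
  exact h z

theorem finrank_phaseSpace_lt : Module.finrank ℝ (Eu d × Eu d) < 2 * d + 1 := by
  rw [Module.finrank_prod, finrank_euclideanSpace_fin]; omega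

instance : (volume : Measure (Eu d × Eu d)).IsAddHaarMeasure :=
  Measure.prod.instIsAddHaarMeasure volume volume

theorem coe_mem_modSpace (g φ : 𝓢(Eu d, ℂ)) {p : ℝ≥0∞} (hp : 1 ≤ p) :
    (φ : 𝓢'(Eu d, ℂ)) ∈ modSpace g p := by
  obtain ⟨C, hC, h⟩ := exists_norm_stft_coe_le g φ (2 * d + 1)
  refine ((memLp_decayWeight finrank_phaseSpace_lt volume hp).const_mul C).mono'
    (continuous_stft g _).aestronglyMeasurable (.of_forall h)

/-- For fixed `x`, the function `η ↦ coeff g φ (x, η)` is the inverse Fourier transform of `φ · T_x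
g`. Integration in `η` is thus Fourier inversion at `y` and yields `|g(y - x)|² φ(y)`; integration
in `x` then gives the constant. -/
theorem integral_coeff_mul_conj_timeFreqShift (g φ : 𝓢(Eu d, ℂ)) (y : Eu d)
    (hI : Integrable fun z => coeff g φ z * conj (timeFreqShift z.1 z.2 g y)) :
    ∫ z, coeff g φ z * conj (timeFreqShift z.1 z.2 g y) = (∫ x, ‖g x‖ ^ 2 : ℝ) * φ y := by
  rw [Measure.volume_eq_prod] at hI ⊢
  rw [integral_prod _ hI]
  have inner_eq : ∀ x, ∫ η, coeff g φ (x, η) * conj (timeFreqShift x η g y) =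
      ((‖g (y - x)‖ ^ 2 : ℝ) : ℂ) * φ y := by
    intro x
    set w : 𝓢(Eu d, ℂ) := SchwartzMap.smulLeftCLM ℂ φ (compSubConstCLM ℂ x g) with hw
    have hwa : ∀ t, w t = φ t * g (t - x) := fun t => by
      rw [hw, SchwartzMap.smulLeftCLM_apply_apply φ.hasTemperateGrowth, compSubConstCLM_apply,
        smul_eq_mul]
    have hc : ∀ η, coeff g φ (x, η) = (𝓕⁻ w) η := fun η => by
      rw [fourierInv_coe, fourierInv_eq_integral_character, coeff]
      refine integral_congr_ae (.of_forall fun t => ?_)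
      simp only [hwa, timeFreqShift_apply]
      ring
    have h2 : (𝓕 (𝓕⁻ w)) y = w y := by rw [FourierTransform.fourier_fourierInv_eq]
    rw [fourier_coe, fourier_eq_integral_character] at h2
    have h3 : ∫ η, coeff g φ (x, η) * conj (timeFreqShift x η g y) =
        conj (g (y - x)) * w y := by
      rw [← h2, ← integral_const_mul]
      refine integral_congr_ae (.of_forall fun η => ?_)
      simp only [hc, timeFreqShift_apply, map_mul, character_comm y η]
      ring
    rw [h3, hwa, Complex.ofReal_pow, ← Complex.conj_mul']
    ring
  simp only [inner_eq]
  rw [integral_mul_const, integral_complex_ofReal, integral_sub_left_eq_self (fun x => ‖g x‖ ^ 2)]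

/-- Inversion formula for the short-time Fourier transform of a tempered distribution. -/
theorem stft_inversion (g φ : 𝓢(Eu d, ℂ)) (f : 𝓢'(Eu d, ℂ)) :
    ((∫ x, ‖g x‖ ^ 2 : ℝ) : ℂ) * f φ = ∫ z, coeff g φ z * stft g f z := by
  set F : Eu d × Eu d → 𝓢(Eu d, ℂ) := fun z =>
    coeff g φ z • conjSchwartz (timeFreqShift z.1 z.2 g) with hF
  have hFc : Continuous F := (continuous_coeff g φ).smul (continuous_conj_timeFreqShift g)
  have hFi : ∀ k l, Integrable (fun z => SchwartzMap.seminorm ℝ k l (F z)) := by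
    intro k l
    obtain ⟨A, n, hA, h1⟩ := polyBounded_conj_timeFreqShift g k l
    -- Here `n` powers absorb the growth of the seminorms, and `2 * d + 1` exceeds the dimension of
    -- phase space.
    obtain ⟨B, hB, h2⟩ := exists_norm_coeff_le g φ (2 * d + 1 + n)
    refine ((integrable_decayWeight finrank_phaseSpace_lt volume).const_mul (B * A)).mono'
      (((schwartz_withSeminorms ℝ (Eu d) ℂ).continuous_seminorm
        (k, l)).comp hFc).aestronglyMeasurable (.of_forall fun z => ?_)
    rw [Real.norm_of_nonneg (apply_nonneg _ _), ← seminorm_complex_eq_real, hF, map_smul_eq_mul,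
      seminorm_complex_eq_real]
    calc _ ≤ (B * decayWeight (2 * d + 1 + n) z) * (A * (1 + ‖z‖) ^ n) := by
          gcongr
          · exact mul_nonneg hB (decayWeight_nonneg _ _)
          · exact h2 z
          · exact h1 z
      _ = _ := by
          simp only [decayWeight]
          field_simp
          ring
  have hpt : ∀ y, (((∫ x, ‖g x‖ ^ 2 : ℝ) : ℂ) • φ) y = ∫ z, F z y := by
    intro y
    have hI : Integrable fun z => coeff g φ z * conj (timeFreqShift z.1 z.2 g y) := by
      refine (hFi 0 0).mono' ?_ (.of_forall fun z => ?_)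
      · have h1 := (continuous_iteratedFDeriv_eval hFc 0 y)
        have h2 := (ContinuousMultilinearMap.apply ℝ (fun _ : Fin 0 => Eu d) ℂ 0).continuous.comp h1
        refine (h2.congr fun z => ?_).aestronglyMeasurable
        simp [hF, conjSchwartz_apply]
      · have := SchwartzMap.norm_le_seminorm ℝ (F z) y
        simpa [hF, conjSchwartz_apply] using this
    have := integral_coeff_mul_conj_timeFreqShift g φ y hI
    simp only [hF, smul_apply, smul_eq_mul, conjSchwartz_apply]
    exact this.symm
  have hs : ∀ (c : ℂ) (ψ : 𝓢(Eu d, ℂ)), f (c • ψ) = c * f ψ := fun c ψ => map_smul f c ψ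
  refine (hs _ _).symm.trans ((map_integral_schwartz hFc hFi hpt f).trans ?_)
  exact integral_congr_ae (.of_forall fun z => hs _ _)

/-! ### Translates of a Schwartz function as functionals on `M^p`. -/

theorem integral_norm_sq_pos {g : 𝓢(Eu d, ℂ)} (hg : g ≠ 0) : 0 < ∫ x, ‖g x‖ ^ 2 := by
  obtain ⟨x, hx⟩ : ∃ x, g x ≠ 0 := by
    by_contra! h
    exact hg (SchwartzMap.ext h)
  exact integral_pos_of_integrable_nonneg_nonzero (x := x) (by fun_prop)
    ((g.memLp 2).integrable_norm_pow (by norm_num)) (fun x => by positivity) (by simpa using hx)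

theorem coeff_translate (g Ψ : 𝓢(Eu d, ℂ)) (b : Eu d) (z : Eu d × Eu d) :
    coeff g (compSubConstCLM ℂ b Ψ) z = character z.2 b * coeff g Ψ (z - (b, 0)) := by
  rw [coeff, coeff, ← integral_const_mul, ← integral_add_right_eq_self _ b]
  refine integral_congr_ae (.of_forall fun y => ?_)
  simp only [timeFreqShift_apply, compSubConstCLM_apply, character_add_right, Prod.fst_sub,
    Prod.snd_sub, sub_zero, add_sub_cancel_right]
  rw [show y + b - z.1 = y - (z.1 - b) by abel]
  ring

/-- Translates of a fixed Schwartz function are uniformly bounded functionals on `M^p`. -/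
theorem exists_enorm_apply_translate_le {g : 𝓢(Eu d, ℂ)} (hg : g ≠ 0) (Ψ : 𝓢(Eu d, ℂ))
    {p : ℝ≥0∞} (hp : 1 ≤ p) :
    ∃ C : ℝ≥0, ∀ (f : 𝓢'(Eu d, ℂ)) (b : Eu d),
      ‖f (compSubConstCLM ℂ b Ψ)‖ₑ ≤ C * modNorm g p f := by
  -- The conjugate exponent; in `ℝ≥0∞` the formula also covers `p = 1` and `p = ∞`.
  set q : ℝ≥0∞ := (1 - p⁻¹)⁻¹ with hq
  have : ENNReal.HolderConjugate p q := ENNReal.HolderConjugate.inv_one_sub_inv' hp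
  have : ENNReal.HolderConjugate q p := ENNReal.HolderConjugate.symm
  have hq1 : 1 ≤ q := ENNReal.HolderConjugate.one_le q p
  obtain ⟨A, hA, h⟩ := exists_norm_coeff_le g Ψ (2 * d + 1)
  have hW := (memLp_decayWeight (V := Eu d × Eu d) finrank_phaseSpace_lt volume hq1).const_mul A
  set c := ∫ x, ‖g x‖ ^ 2 with hc
  have hc0 : 0 < c := integral_norm_sq_pos hg
  refine ⟨‖(c : ℂ)‖₊⁻¹ * (eLpNorm (fun z : Eu d × Eu d => A * decayWeight (2 * d + 1) z) q
    volume).toNNReal, fun f b => ?_⟩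
  have h1 : f (compSubConstCLM ℂ b Ψ) =
      (c : ℂ)⁻¹ * ∫ z, coeff g (compSubConstCLM ℂ b Ψ) z * stft g f z := by
    rw [← stft_inversion, ← mul_assoc, inv_mul_cancel₀ (by exact_mod_cast hc0.ne'), one_mul]
  have h2 : eLpNorm (coeff g (compSubConstCLM ℂ b Ψ)) q volume ≤
      eLpNorm (fun z : Eu d × Eu d => A * decayWeight (2 * d + 1) z) q volume := by
    -- Translating `Ψ` by `b` translates the modulus of its coefficients in phase space, so the
    -- `L^q` bound does not depend on `b`.
    have hmp := measurePreserving_sub_right (volume : Measure (Eu d × Eu d)) (b, (0 : Eu d))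
    rw [← eLpNorm_comp_measurePreserving hW.1 hmp]
    refine eLpNorm_mono_real fun z => ?_
    rw [coeff_translate, norm_mul, norm_character, one_mul]
    exact h _
  rw [h1, enorm_mul, ENNReal.coe_mul, mul_assoc]
  rw [enorm_inv (by exact_mod_cast hc0.ne'), ENNReal.coe_inv (by simpa using hc0.ne')]
  refine mul_le_mul_right ?_ _
  rw [ENNReal.coe_toNNReal hW.2.ne]
  calc _ ≤ ∫⁻ z, ‖coeff g (compSubConstCLM ℂ b Ψ) z * stft g f z‖ₑ :=
        enorm_integral_le_lintegral_enorm _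
    _ = eLpNorm (coeff g (compSubConstCLM ℂ b Ψ) • stft g f) 1 volume := by
        rw [eLpNorm_one_eq_lintegral_enorm]; rfl
    _ ≤ eLpNorm (coeff g (compSubConstCLM ℂ b Ψ)) q volume * eLpNorm (stft g f) p volume :=
        eLpNorm_smul_le_mul_eLpNorm (continuous_stft g f).aestronglyMeasurable
          (continuous_coeff _ _).aestronglyMeasurable
    _ ≤ _ := by gcongr; exact le_rfl

/-! ### Dyadic representation of the kernel. -/

/-- The Euclidean space of triples `(t, x, η)`. -/
abbrev Triple (d : ℕ) : Type := WithLp 2 (ℝ × WithLp 2 (Eu d × Eu d))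

/-- The triple `(t, x, η)`. -/
def triple (t : ℝ) (x η : Eu d) : Triple d := WithLp.toLp 2 (t, WithLp.toLp 2 (x, η))

/-- Forgetting the Euclidean norm on triples. -/
def tripleEquiv (d : ℕ) : Triple d ≃L[ℝ] ℝ × Eu d × Eu d :=
  (WithLp.prodContinuousLinearEquiv 2 ℝ ℝ (WithLp 2 (Eu d × Eu d))).trans
    ((ContinuousLinearEquiv.refl ℝ ℝ).prodCongr (WithLp.prodContinuousLinearEquiv 2 ℝ (Eu d) (Eu d)))

theorem inner_triple (e : Triple d) (t : ℝ) (x η : Eu d) :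
    inner ℝ e (triple t x η) = (tripleEquiv d e).1 * t + inner ℝ (tripleEquiv d e).2.1 x +
      inner ℝ (tripleEquiv d e).2.2 η := by
  rw [WithLp.prod_inner_apply, WithLp.prod_inner_apply, add_assoc]
  congr 1
  exact mul_comm _ _

/-- Smooth functions of `(t, x, η)` with bounded support are Schwartz functions. -/
theorem exists_schwartz_triple {m : ℝ × Eu d × Eu d → ℂ} (hm : ContDiff ℝ ∞ m) (r : ℝ)
    (hr : ∀ q, m q ≠ 0 → ‖q‖ ≤ r) :
    ∃ M : 𝓢(Triple d, ℂ), ∀ t x η, M (triple t x η) = m (t, x, η) := by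
  have hc : HasCompactSupport m := by
    refine HasCompactSupport.intro (isCompact_closedBall 0 r) fun q hq => ?_
    by_contra h
    exact hq (by simpa using hr q h)
  have hc' : HasCompactSupport (m ∘ tripleEquiv d) :=
    hc.comp_homeomorph (tripleEquiv d).toHomeomorph
  exact ⟨hc'.toSchwartzMap (hm.comp (tripleEquiv d).contDiff), fun t x η => rfl⟩

/-- The entire function `(e^{2πis} - 1) / s`, on the real line. -/
def expQuotient (s : ℝ) : ℂ :=
  dslope (fun z : ℂ => Complex.exp (2 * Real.pi * Complex.I * z)) 0 s

/-- The singularity at the origin is removable, so the divided difference is entire. -/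
theorem contDiff_expQuotient : ContDiff ℝ ∞ expQuotient := by
  have h0 : Differentiable ℂ (fun z : ℂ => Complex.exp (2 * Real.pi * Complex.I * z)) := by
    fun_prop
  have h1 : Differentiable ℂ (dslope (fun z : ℂ => Complex.exp (2 * Real.pi * Complex.I * z)) 0) := by
    rw [← differentiableOn_univ] at h0 ⊢
    exact (Complex.differentiableOn_dslope Filter.univ_mem).2 h0
  have h2 := (h1.contDiff (n := ∞)).restrict_scalars ℝ
  exact h2.comp Complex.ofRealCLM.contDiff

theorem mul_expQuotient (s : ℝ) :
    s * expQuotient s = Complex.exp (2 * Real.pi * Complex.I * s) - 1 := by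
  have := sub_smul_dslope (fun z : ℂ => Complex.exp (2 * Real.pi * Complex.I * z)) 0 s
  simpa [expQuotient] using this

section Dyadic

variable {σ : Eu d → Eu d → ℂ} {R : ℝ} {Φ : Eu d → Eu d → ℝ}

/-- A smooth dyadic partition of unity. -/
theorem exists_dyadic_partition (hR : 0 < R) :
    ∃ ψ : Eu d → ℝ, ContDiff ℝ ∞ ψ ∧ (∀ η, ψ η ≠ 0 → ‖η‖ ≤ 2 * R) ∧
      (∀ η, ‖η‖ < R / 2 → ψ η = 0) ∧
      ∀ η, η ≠ 0 → ‖η‖ ≤ R → HasSum (fun j : ℕ => ψ ((2 : ℝ) ^ j • η)) 1 := by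
  let χ : ContDiffBump (0 : Eu d) := ⟨R, 2 * R, hR, by linarith⟩
  have hχ1 : ∀ η, ‖η‖ ≤ R → χ η = 1 := fun η h =>
    χ.one_of_mem_closedBall (by simpa using h)
  have hχ0 : ∀ η, 2 * R ≤ ‖η‖ → χ η = 0 := fun η h =>
    χ.zero_of_le_dist (by simpa using h)
  -- With this choice the dyadic sum telescopes to `χ η`, which is `1` on the ball of radius `R`.
  refine ⟨fun η => χ η - χ ((2 : ℝ) • η), ?_, fun η h => ?_, fun η h => ?_, fun η h0 hηR => ?_⟩
  · exact χ.contDiff.sub (χ.contDiff.comp (contDiff_const_smul _))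
  · by_contra! h2
    refine h ?_
    show χ η - χ ((2 : ℝ) • η) = 0
    rw [hχ0 η h2.le, hχ0 _ (by rw [norm_smul]; norm_num; linarith [norm_nonneg η]), sub_zero]
  · show χ η - χ ((2 : ℝ) • η) = 0
    rw [hχ1 η (by linarith), hχ1 _ (by rw [norm_smul]; norm_num; linarith), sub_self]
  · have hη : 0 < ‖η‖ := norm_pos_iff.2 h0
    obtain ⟨J, hJ⟩ := pow_unbounded_of_one_lt (2 * R / ‖η‖) (one_lt_two (α := ℝ))
    have hbig : ∀ j, J ≤ j → χ ((2 : ℝ) ^ j • η) = 0 := fun j hj => by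
      refine hχ0 _ ?_
      rw [norm_smul, norm_pow, Real.norm_two]
      rw [div_lt_iff₀ hη] at hJ
      exact hJ.le.trans (by gcongr; norm_num)
    have hterm : ∀ j : ℕ, χ ((2 : ℝ) ^ j • η) - χ ((2 : ℝ) • (2 : ℝ) ^ j • η) =
        χ ((2 : ℝ) ^ j • η) - χ ((2 : ℝ) ^ (j + 1) • η) := fun j => by
      rw [smul_smul, pow_succ']
    simp only [hterm]
    have hs : HasSum (fun j : ℕ => χ ((2 : ℝ) ^ j • η) - χ ((2 : ℝ) ^ (j + 1) • η))
        (∑ j ∈ Finset.range J, (χ ((2 : ℝ) ^ j • η) - χ ((2 : ℝ) ^ (j + 1) • η))) :=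
      hasSum_sum_of_ne_finset_zero fun j hj => by
        have : J ≤ j := by simpa using hj
        rw [hbig j this, hbig (j + 1) (by omega), sub_zero]
    rw [Finset.sum_range_sub' (fun j : ℕ => χ ((2 : ℝ) ^ j • η)), hbig J le_rfl, pow_zero,
      one_smul, hχ1 η hηR, sub_zero] at hs
    exact hs

/-- A cutoff in `t` selecting `t = 1` among the dyadic points. -/
theorem exists_cutoff_one : ∃ ρ : ℝ → ℝ, ContDiff ℝ ∞ ρ ∧ (∀ t, ρ t ≠ 0 → ‖t‖ ≤ 2) ∧
    ρ 1 = 1 ∧ ∀ j : ℕ, j ≠ 0 → ρ ((2⁻¹ : ℝ) ^ j) = 0 := by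
  -- The nearest other dyadic point is `1/2`, at distance exactly the outer radius, where the bump
  -- already vanishes.
  let χ : ContDiffBump (1 : ℝ) := ⟨1 / 4, 1 / 2, by norm_num, by norm_num⟩
  refine ⟨χ, χ.contDiff, fun t ht => ?_, χ.one_of_mem_closedBall (by simp; norm_num),
    fun j hj => χ.zero_of_le_dist ?_⟩
  · by_contra! h
    refine ht (χ.zero_of_le_dist ?_)
    show 1 / 2 ≤ dist t 1
    rw [Real.dist_eq]
    have := norm_sub_norm_le t 1
    rw [Real.norm_eq_abs (t - 1), norm_one] at this
    linarith
  · show 1 / 2 ≤ dist ((2⁻¹ : ℝ) ^ j) 1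
    have h1 : (2⁻¹ : ℝ) ^ j ≤ 2⁻¹ := by
      obtain ⟨i, rfl⟩ := Nat.exists_eq_succ_of_ne_zero hj
      rw [pow_succ]
      exact mul_le_of_le_one_left (by norm_num) (pow_le_one₀ (by norm_num) (by norm_num))
    rw [Real.dist_eq, abs_sub_comm]
    exact le_trans (by norm_num at h1 ⊢; linarith) (le_abs_self _)

/-- Only the values `t = 2^{-j}`, all in the unit ball, are ever used; the cutoff makes the support
in `t` bounded without changing them. -/
theorem exists_cutoff_zero : ∃ ρ : ℝ → ℝ, ContDiff ℝ ∞ ρ ∧ (∀ t, ρ t ≠ 0 → ‖t‖ ≤ 2) ∧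
    ∀ j : ℕ, ρ ((2⁻¹ : ℝ) ^ j) = 1 := by
  let χ : ContDiffBump (0 : ℝ) := ⟨1, 2, by norm_num, by norm_num⟩
  refine ⟨χ, χ.contDiff, fun t ht => ?_, fun j => χ.one_of_mem_closedBall ?_⟩
  · by_contra! h
    exact ht (χ.zero_of_le_dist (by simpa using h.le))
  · rw [mem_closedBall_zero_iff, norm_pow]
    exact pow_le_one₀ (norm_nonneg _) (by norm_num)

/-- Near `η = 0` the factor `ψ` annihilates the product; elsewhere `Φ` is smooth. No division by `t`
or `Φ` occurs, so `t = 0` and the zeros of `Φ` are harmless. -/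
theorem contDiff_dyadicPart
    (hσ : ContDiff ℝ ∞ (fun z : Eu d × Eu d => σ z.1 z.2))
    (hΦ : ContDiffOn ℝ ∞ (fun z : Eu d × Eu d => Φ z.1 z.2) (Set.univ ×ˢ {0}ᶜ))
    {ψ : Eu d → ℝ} (hψ : ContDiff ℝ ∞ ψ) {r : ℝ} (hr : 0 < r) (hψ0 : ∀ η, ‖η‖ < r → ψ η = 0) :
    ContDiff ℝ ∞ fun q : ℝ × Eu d × Eu d =>
      (Φ q.2.1 q.2.2 : ℂ) * ψ q.2.2 * expQuotient (q.1 * Φ q.2.1 q.2.2) *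
        σ q.2.1 (q.1 • q.2.2) := by
  rw [contDiff_iff_contDiffAt]
  rintro ⟨t, x, η⟩
  by_cases hη : η = 0
  · have : ∀ᶠ q : ℝ × Eu d × Eu d in nhds (t, x, η), ‖q.2.2‖ < r := by
      refine (by fun_prop : Continuous fun q : ℝ × Eu d × Eu d => ‖q.2.2‖).continuousAt.eventually_lt
        continuousAt_const ?_
      simpa [hη] using hr
    refine (contDiffAt_const (c := (0 : ℂ))).congr_of_eventuallyEq ?_
    filter_upwards [this] with q hq
    simp [hψ0 _ hq]
  · have hopen : (Set.univ ×ˢ {0}ᶜ : Set (Eu d × Eu d)) ∈ nhds (x, η) :=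
      (isOpen_univ.prod isOpen_compl_singleton).mem_nhds ⟨trivial, hη⟩
    have h1 : ContDiffAt ℝ ∞ (fun q : ℝ × Eu d × Eu d => Φ q.2.1 q.2.2) (t, x, η) :=
      (hΦ.contDiffAt hopen).comp (f := fun q : ℝ × Eu d × Eu d => q.2) (t, x, η) contDiffAt_snd
    have h2 : ContDiffAt ℝ ∞ (fun q : ℝ × Eu d × Eu d => (Φ q.2.1 q.2.2 : ℂ)) (t, x, η) :=
      Complex.ofRealCLM.contDiff.contDiffAt.comp (t, x, η) h1
    have h3 : ContDiffAt ℝ ∞ (fun q : ℝ × Eu d × Eu d => (ψ q.2.2 : ℂ)) (t, x, η) :=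
      (Complex.ofRealCLM.contDiff.comp (hψ.comp (contDiff_snd.comp contDiff_snd))).contDiffAt
    have h4 : ContDiffAt ℝ ∞ (fun q : ℝ × Eu d × Eu d => expQuotient (q.1 * Φ q.2.1 q.2.2))
        (t, x, η) := contDiff_expQuotient.contDiffAt.comp (t, x, η) (contDiffAt_fst.mul h1)
    have h5 : ContDiff ℝ ∞ (fun q : ℝ × Eu d × Eu d => σ q.2.1 (q.1 • q.2.2)) :=
      hσ.comp ((contDiff_fst.comp contDiff_snd).prodMk
        (contDiff_fst.smul (contDiff_snd.comp contDiff_snd)))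
    exact ((h2.mul h3).mul h4).mul h5.contDiffAt

/-- The kernel `e^{2πiΦ} σ` is a superposition of dyadic dilates of a single Schwartz function. -/
theorem exists_dyadic_representation
    (hσ : ContDiff ℝ ∞ (fun z : Eu d × Eu d => σ z.1 z.2)) (hR : 0 < R)
    (hσR : ∀ x η : Eu d, R ≤ ‖x‖ + ‖η‖ → σ x η = 0)
    (hΦ : ContDiffOn ℝ ∞ (fun z : Eu d × Eu d => Φ z.1 z.2) (Set.univ ×ˢ {0}ᶜ))
    (hΦ_hom : ∀ (x η : Eu d) (t : ℝ), η ≠ 0 → 0 < t → Φ x (t • η) = t * Φ x η) :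
    ∃ M : 𝓢(Triple d, ℂ), ∀ x, ∀ᵐ η : Eu d,
      HasSum (fun j : ℕ => (2⁻¹ : ℂ) ^ j * M (triple ((2⁻¹ : ℝ) ^ j) x ((2 : ℝ) ^ j • η)))
        (Complex.exp (2 * Real.pi * Complex.I * Φ x η) * σ x η) := by
  obtain ⟨ρ₁, hρ₁, hρ₁2, hρ₁1, hρ₁0⟩ := exists_cutoff_one
  have hρ₁c : ContDiff ℝ ∞ fun t => (ρ₁ t : ℂ) := Complex.ofRealCLM.contDiff.comp hρ₁
  -- In dimension zero the point `0` is not negligible and the partition says nothing there; the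
  -- kernel is a single number, placed entirely in the term `j = 0`.
  rcases Nat.eq_zero_or_pos d with hd | hd
  · subst hd
    obtain ⟨M, hM⟩ := exists_schwartz_triple (d := 0)
      (m := fun q => ρ₁ q.1 * (Complex.exp (2 * Real.pi * Complex.I * Φ 0 0) * σ 0 0))
      ((hρ₁c.comp contDiff_fst).mul contDiff_const) 2 fun q hq => by
        have h1 : ρ₁ q.1 ≠ 0 := fun h => hq (by simp [h])
        have h2 : q.2 = 0 := Subsingleton.elim _ _
        rw [Prod.norm_def, h2, norm_zero]
        exact max_le (hρ₁2 _ h1) zero_le_two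
    refine ⟨M, fun x => .of_forall fun η => ?_⟩
    rw [Subsingleton.elim x 0, Subsingleton.elim η 0]
    convert hasSum_single (f := fun j : ℕ => (2⁻¹ : ℂ) ^ j *
      M (triple ((2⁻¹ : ℝ) ^ j) 0 ((2 : ℝ) ^ j • 0))) 0 fun j hj => ?_ using 1
    · simp [hM, hρ₁1]
    · rw [hM, hρ₁0 j hj]
      simp
  obtain ⟨ρ₀, hρ₀, hρ₀2, hρ₀1⟩ := exists_cutoff_zero
  obtain ⟨ψ, hψ, hψ2, hψ0, hψs⟩ := exists_dyadic_partition (d := d) hR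
  have hρ₀c : ContDiff ℝ ∞ fun t => (ρ₀ t : ℂ) := Complex.ofRealCLM.contDiff.comp hρ₀
  -- The factor `ρ₁` lets `σ` itself contribute only at `j = 0`; the second summand carries
  -- `(e^{2πiΦ} - 1)σ`, spread over all scales.
  obtain ⟨M, hM⟩ := exists_schwartz_triple (d := d)
    (m := fun q => ρ₁ q.1 * σ q.2.1 q.2.2 + ρ₀ q.1 * ((Φ q.2.1 q.2.2 : ℂ) * ψ q.2.2 *
      expQuotient (q.1 * Φ q.2.1 q.2.2) * σ q.2.1 (q.1 • q.2.2)))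
    (((hρ₁c.comp contDiff_fst).mul (hσ.comp contDiff_snd)).add
      ((hρ₀c.comp contDiff_fst).mul (contDiff_dyadicPart hσ hΦ hψ (half_pos hR) hψ0)))
    (2 + 2 * R) fun q hq => by
      have hx : ∀ η, σ q.2.1 η ≠ 0 → ‖q.2.1‖ ≤ 2 + 2 * R := fun η h => by
        by_contra! hlt
        exact h (hσR _ _ (by linarith [norm_nonneg η]))
      have hη : σ q.2.1 q.2.2 ≠ 0 → ‖q.2.2‖ ≤ 2 + 2 * R := fun h => by
        by_contra! hlt
        exact h (hσR _ _ (by linarith [norm_nonneg q.2.1]))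
      by_cases hA : (ρ₁ q.1 : ℂ) * σ q.2.1 q.2.2 = 0
      · simp only [hA, zero_add] at hq
        have h0 : ρ₀ q.1 ≠ 0 := fun h => hq (by simp [h])
        have h1 : ψ q.2.2 ≠ 0 := fun h => hq (by simp [h])
        have h2 : σ q.2.1 (q.1 • q.2.2) ≠ 0 := fun h => hq (by simp [h])
        exact max_le ((hρ₀2 _ h0).trans (by linarith))
          (max_le (hx _ h2) ((hψ2 _ h1).trans (by linarith)))
      · have h0 : ρ₁ q.1 ≠ 0 := fun h => hA (by simp [h])
        have h1 : σ q.2.1 q.2.2 ≠ 0 := fun h => hA (by simp [h])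
        exact max_le ((hρ₁2 _ h0).trans (by linarith)) (max_le (hx _ h1) (hη h1))
  refine ⟨M, fun x => ?_⟩
  have : Nonempty (Fin d) := ⟨⟨0, hd⟩⟩
  filter_upwards [compl_mem_ae_iff.2 (measure_singleton (0 : Eu d))] with η hη
  have hη : η ≠ 0 := hη
  set X : ℂ := Complex.exp (2 * Real.pi * Complex.I * Φ x η) with hX
  have hterm : ∀ j : ℕ, (2⁻¹ : ℂ) ^ j * M (triple ((2⁻¹ : ℝ) ^ j) x ((2 : ℝ) ^ j • η)) =
      (if j = 0 then σ x η else 0) + (X - 1) * σ x η * (ψ ((2 : ℝ) ^ j • η) : ℝ) := by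
    intro j
    have hpos : (0 : ℝ) < 2 ^ j := by positivity
    have hscale : (2⁻¹ : ℝ) ^ j • (2 : ℝ) ^ j • η = η := by
      rw [smul_smul, ← mul_pow]; norm_num
    -- Homogeneity enters here: at scale `j` the exponential quotient has argument `Φ x η` for every
    -- `j`, and the weight `2^{-j}` restores the factor `Φ x η`.
    have hΦj : (2⁻¹ : ℝ) ^ j * Φ x ((2 : ℝ) ^ j • η) = Φ x η := by
      rw [hΦ_hom x η _ hη hpos, ← mul_assoc, ← mul_pow]; norm_num
    have hΦc : (2⁻¹ : ℂ) ^ j * (Φ x ((2 : ℝ) ^ j • η) : ℂ) = Φ x η := by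
      rw [← hΦj]; push_cast; ring
    simp only [hM, hρ₀1, hscale, hΦj, Complex.ofReal_one, one_mul]
    have hq := mul_expQuotient (Φ x η)
    rw [mul_add]
    congr 1
    · split_ifs with hj
      · subst hj; simp [hρ₁1]
      · rw [hρ₁0 j hj]
        simp
    · rw [hX, ← hq]
      linear_combination (ψ ((2 : ℝ) ^ j • η) * expQuotient (Φ x η) * σ x η : ℂ) * hΦc
  simp only [hterm]
  have hs1 : HasSum (fun j : ℕ => if j = 0 then σ x η else 0) (σ x η) := hasSum_ite_eq 0 _
  have hs2 : HasSum (fun j : ℕ => (X - 1) * σ x η * (ψ ((2 : ℝ) ^ j • η) : ℝ))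
      ((X - 1) * σ x η) := by
    by_cases hbig : R ≤ ‖η‖
    · rw [hσR x η (by linarith [norm_nonneg x])]
      simp
    · have := (Complex.hasSum_ofReal.2 (hψs η hη (not_le.1 hbig).le)).mul_left ((X - 1) * σ x η)
      simpa using this
  convert hs1.add hs2 using 1
  ring

end Dyadic

/-! ### Superpositions of modulations of a cutoff. -/

/-- The component `t` of a triple. -/
def scalePart : Triple d →L[ℝ] ℝ :=
  (ContinuousLinearMap.fst ℝ ℝ (Eu d × Eu d)).comp (tripleEquiv d : Triple d →L[ℝ] _)

/-- The component `x` of a triple. -/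
def spacePart : Triple d →L[ℝ] Eu d :=
  (ContinuousLinearMap.fst ℝ (Eu d) (Eu d)).comp
    ((ContinuousLinearMap.snd ℝ ℝ (Eu d × Eu d)).comp (tripleEquiv d : Triple d →L[ℝ] _))

/-- The component `η` of a triple. -/
def freqPart : Triple d →L[ℝ] Eu d :=
  (ContinuousLinearMap.snd ℝ (Eu d) (Eu d)).comp
    ((ContinuousLinearMap.snd ℝ ℝ (Eu d × Eu d)).comp (tripleEquiv d : Triple d →L[ℝ] _))

theorem norm_spacePart_le (e : Triple d) : ‖spacePart e‖ ≤ ‖e‖ :=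
  (WithLp.norm_fst_le _ e.snd).trans (WithLp.norm_snd_le _ e)

theorem fourierChar_inner_triple (e : Triple d) (t : ℝ) (x η : Eu d) :
    (Real.fourierChar (inner ℝ e (triple t x η)) : ℂ) =
      Real.fourierChar (scalePart e * t) * character (spacePart e) x *
        character (freqPart e) η := by
  rw [inner_triple, AddChar.map_add_eq_mul, AddChar.map_add_eq_mul, Circle.coe_mul,
    Circle.coe_mul, character_eq_fourierChar, character_eq_fourierChar, real_inner_comm x,
    real_inner_comm η]
  rfl

theorem schwartz_triple_eq_integral (M : 𝓢(Triple d, ℂ)) (t : ℝ) (x η : Eu d) :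
    M (triple t x η) = ∫ e, 𝓕 M e * (Real.fourierChar (scalePart e * t) *
      character (spacePart e) x * character (freqPart e) η) := by
  have h : M = 𝓕⁻ (𝓕 M) := by rw [FourierTransform.fourierInv_fourier_eq]
  conv_lhs => rw [h, fourierInv_coe, Real.fourierInv_eq]
  refine integral_congr_ae (.of_forall fun e => ?_)
  simp only [Circle.smul_def, smul_eq_mul, fourierChar_inner_triple]
  ring

/-- The sum `∑ 2^{-j} e^{2πi 2^{-j} t} λ(2^j η)` over dyadic scales. -/
def dyadicSum (lam : BoundedContinuousFunction (Eu d) ℂ) (e : Triple d) : ℂ :=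
  ∑' j : ℕ, (2⁻¹ : ℂ) ^ j * Real.fourierChar (scalePart e * (2⁻¹ : ℝ) ^ j) *
    lam ((2 : ℝ) ^ j • freqPart e)

theorem norm_dyadicSum_term_le (lam : BoundedContinuousFunction (Eu d) ℂ) (j : ℕ)
    (e : Triple d) :
    ‖(2⁻¹ : ℂ) ^ j * Real.fourierChar (scalePart e * (2⁻¹ : ℝ) ^ j) *
      lam ((2 : ℝ) ^ j • freqPart e)‖ ≤ (2⁻¹ : ℝ) ^ j * ‖lam‖ := by
  rw [norm_mul, norm_mul, Circle.norm_coe, mul_one, norm_pow, norm_inv, Complex.norm_ofNat]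
  exact mul_le_mul_of_nonneg_left (lam.norm_coe_le_norm _) (by positivity)

theorem summable_inv_two_pow : Summable fun j : ℕ => (2⁻¹ : ℝ) ^ j := by
  simpa using summable_geometric_two

theorem summable_dyadicSum (lam : BoundedContinuousFunction (Eu d) ℂ) (e : Triple d) :
    Summable fun j : ℕ => (2⁻¹ : ℂ) ^ j * Real.fourierChar (scalePart e * (2⁻¹ : ℝ) ^ j) *
      lam ((2 : ℝ) ^ j • freqPart e) :=
  .of_norm_bounded (summable_inv_two_pow.mul_right _) fun j => norm_dyadicSum_term_le lam j e

theorem continuous_dyadicSum_term (lam : BoundedContinuousFunction (Eu d) ℂ) (j : ℕ) :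
    Continuous fun e : Triple d =>
      (2⁻¹ : ℂ) ^ j * Real.fourierChar (scalePart e * (2⁻¹ : ℝ) ^ j) *
        lam ((2 : ℝ) ^ j • freqPart e) := by
  have h1 : Continuous fun e : Triple d =>
      (Real.fourierChar (scalePart e * (2⁻¹ : ℝ) ^ j) : ℂ) :=
    continuous_subtype_val.comp (Real.continuous_fourierChar.comp (by fun_prop))
  have h2 : Continuous fun e : Triple d => lam ((2 : ℝ) ^ j • freqPart e) :=
    lam.continuous.comp (by fun_prop)
  exact (continuous_const.mul h1).mul h2

theorem continuous_dyadicSum (lam : BoundedContinuousFunction (Eu d) ℂ) :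
    Continuous (dyadicSum lam) :=
  continuous_tsum (continuous_dyadicSum_term lam) (summable_inv_two_pow.mul_right _)
    (norm_dyadicSum_term_le lam)

theorem norm_dyadicSum_le (lam : BoundedContinuousFunction (Eu d) ℂ) (e : Triple d) :
    ‖dyadicSum lam e‖ ≤ 2 * ‖lam‖ := by
  have h := tsum_of_norm_bounded ((summable_inv_two_pow.mul_right ‖lam‖).hasSum)
    fun j => norm_dyadicSum_term_le lam j e
  rwa [tsum_mul_right, tsum_geometric_inv_two] at h

theorem dyadicSum_add (lam mu : BoundedContinuousFunction (Eu d) ℂ) (e : Triple d) :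
    dyadicSum (lam + mu) e = dyadicSum lam e + dyadicSum mu e := by
  rw [dyadicSum, dyadicSum, dyadicSum, ← (summable_dyadicSum lam e).tsum_add
    (summable_dyadicSum mu e)]
  simp only [BoundedContinuousFunction.coe_add, Pi.add_apply, mul_add]

theorem dyadicSum_smul (c : ℂ) (lam : BoundedContinuousFunction (Eu d) ℂ) (e : Triple d) :
    dyadicSum (c • lam) e = c * dyadicSum lam e := by
  rw [dyadicSum, dyadicSum, ← tsum_mul_left]
  refine tsum_congr fun j => ?_
  simp only [BoundedContinuousFunction.coe_smul, smul_eq_mul]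
  ring

theorem integrable_weighted_mul_dyadicSum (m : 𝓢(Triple d, ℂ))
    (lam : BoundedContinuousFunction (Eu d) ℂ) (N : ℕ) :
    Integrable fun e => (1 + ‖e‖) ^ N * ‖m e * dyadicSum lam e‖ := by
  have hc := continuous_dyadicSum lam
  refine ((integrable_weighted_norm volume m N).mul_const (2 * ‖lam‖)).mono'
    (Continuous.aestronglyMeasurable (by fun_prop)) (.of_forall fun e => ?_)
  rw [Real.norm_of_nonneg (by positivity), norm_mul, ← mul_assoc]
  exact mul_le_mul_of_nonneg_left (norm_dyadicSum_le lam e) (by positivity)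

theorem integrable_mul_dyadicSum (m : 𝓢(Triple d, ℂ))
    (lam : BoundedContinuousFunction (Eu d) ℂ) :
    Integrable fun e => m e * dyadicSum lam e := by
  have h := integrable_weighted_mul_dyadicSum m lam 0
  simp only [pow_zero, one_mul] at h
  exact (integrable_norm_iff
    (m.continuous.mul (continuous_dyadicSum lam)).aestronglyMeasurable).1 h

/-- The superposition of characters `∫ m(e) Λ(e) e^{2πi a·x} de`. -/
def superposition (m : 𝓢(Triple d, ℂ)) (lam : BoundedContinuousFunction (Eu d) ℂ)
    (x : Eu d) : ℂ :=
  ∫ e, m e * dyadicSum lam e * character (spacePart e) x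

theorem integrable_superposition (m : 𝓢(Triple d, ℂ))
    (lam : BoundedContinuousFunction (Eu d) ℂ) (x : Eu d) :
    Integrable fun e => m e * dyadicSum lam e * character (spacePart e) x :=
  (integrable_mul_dyadicSum m lam).mul_bdd (c := 1)
    (Continuous.aestronglyMeasurable (by fun_prop))
    (.of_forall fun e => (norm_character _ _).le)

/-- It is a Fourier integral of a density all of whose moments are finite: `dyadicSum lam` is
bounded and `m` decays rapidly. -/
theorem contDiff_superposition (m : 𝓢(Triple d, ℂ))
    (lam : BoundedContinuousFunction (Eu d) ℂ) : ContDiff ℝ ∞ (superposition m lam) := by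
  -- The minus sign in the linear map compensates the sign in the exponent of the Fourier integral.
  have h := VectorFourier.contDiff_fourierIntegral (μ := (volume : Measure (Triple d)))
    (N := ⊤) (f := fun e => m e * dyadicSum lam e) (-(innerSL ℝ (E := Eu d)).comp spacePart)
    fun n _ => by
      have hc := continuous_dyadicSum lam
      refine (integrable_weighted_mul_dyadicSum m lam n).mono'
        (Continuous.aestronglyMeasurable (by fun_prop)) (.of_forall fun e => ?_)
      rw [Real.norm_of_nonneg (by positivity)]
      gcongr
      linarith
  refine (congrArg (ContDiff ℝ ∞) (funext fun x => ?_)).mpr h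
  rw [superposition, VectorFourier.fourierIntegral]
  refine integral_congr_ae (.of_forall fun e => ?_)
  simp only [character_eq_fourierChar, Circle.smul_def, smul_eq_mul]
  rw [mul_comm]
  congr 3
  simp [real_inner_comm]

/-- The superposition cut off by a compactly supported function. -/
def synthesis (X : 𝓢(Eu d, ℂ)) (hX : HasCompactSupport X) (m : 𝓢(Triple d, ℂ)) :
    BoundedContinuousFunction (Eu d) ℂ →ₗ[ℂ] 𝓢(Eu d, ℂ) where
  toFun lam := (hX.mul_right (f' := superposition m lam)).toSchwartzMap
    ((X.smooth ⊤).mul (contDiff_superposition m lam))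
  map_add' lam mu := by
    ext x
    show X x * superposition m (lam + mu) x =
      X x * superposition m lam x + X x * superposition m mu x
    rw [← mul_add, superposition, superposition, superposition,
      ← integral_add (integrable_superposition m lam x) (integrable_superposition m mu x)]
    congr 1
    refine integral_congr_ae (.of_forall fun e => ?_)
    simp only [dyadicSum_add]; ring
  map_smul' c lam := by
    ext x
    show X x * superposition m (c • lam) x = c * (X x * superposition m lam x)
    rw [mul_left_comm c, superposition, superposition, ← integral_const_mul c]
    congr 1
    refine integral_congr_ae (.of_forall fun e => ?_)
    simp only [dyadicSum_smul]; ring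

theorem synthesis_apply (X : 𝓢(Eu d, ℂ)) (hX : HasCompactSupport X) (m : 𝓢(Triple d, ℂ))
    (lam : BoundedContinuousFunction (Eu d) ℂ) (x : Eu d) :
    synthesis X hX m lam x = X x * superposition m lam x := rfl

theorem decayWeight_sub_le {V : Type*} [NormedAddCommGroup V] (N : ℕ) (z w : V) :
    decayWeight N (z - w) ≤ (1 + ‖w‖) ^ N * decayWeight N z := by
  rw [decayWeight, decayWeight, ← div_eq_mul_inv, le_div_iff₀ (by positivity), mul_comm,
    ← div_eq_mul_inv, div_le_iff₀ (by positivity), ← mul_pow]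
  gcongr
  have := norm_add_le (z - w) w
  rw [sub_add_cancel] at this
  nlinarith [norm_nonneg (z - w), norm_nonneg w]

/-- Fubini, together with the fact that modulating `X` by `a` shifts its short-time transform by
`(0, a)`. -/
theorem stft_synthesis (g X : 𝓢(Eu d, ℂ)) (hX : HasCompactSupport X) (m : 𝓢(Triple d, ℂ))
    (lam : BoundedContinuousFunction (Eu d) ℂ) (z : Eu d × Eu d) :
    stft g (synthesis X hX m lam : 𝓢'(Eu d, ℂ)) z =
      ∫ e, m e * dyadicSum lam e *
        stft g (X : 𝓢'(Eu d, ℂ)) (z - ((0 : Eu d), spacePart e)) := by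
  set w : 𝓢(Eu d, ℂ) := conjSchwartz (timeFreqShift z.1 z.2 g) with hw
  have hwX : Integrable fun y => w y * X y :=
    X.integrable.bdd_mul (c := SchwartzMap.seminorm ℝ 0 0 w) w.continuous.aestronglyMeasurable
      (.of_forall fun y => SchwartzMap.norm_le_seminorm ℝ w y)
  have hI : Integrable (Function.uncurry fun (y : Eu d) (e : Triple d) =>
      (w y * X y) * (m e * dyadicSum lam e) * character (spacePart e) y)
      (volume.prod volume) :=
    (hwX.mul_prod (integrable_mul_dyadicSum m lam)).mul_bdd (c := 1)
      (g := fun q : Eu d × Triple d => character (spacePart q.2) q.1)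
      (Continuous.aestronglyMeasurable (by fun_prop))
      (.of_forall fun q => (norm_character _ _).le)
  have h1 : stft g (synthesis X hX m lam : 𝓢'(Eu d, ℂ)) z =
      ∫ y, ∫ e, (w y * X y) * (m e * dyadicSum lam e) * character (spacePart e) y := by
    rw [stft, coe_apply]
    refine integral_congr_ae (.of_forall fun y => ?_)
    simp only [synthesis_apply, superposition, smul_eq_mul]
    rw [← mul_assoc, ← integral_const_mul]
    refine integral_congr_ae (.of_forall fun e => ?_)
    simp only [hw]; ring
  rw [h1, integral_integral_swap hI]
  refine integral_congr_ae (.of_forall fun e => ?_)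
  simp only
  rw [stft, coe_apply, ← integral_const_mul]
  refine integral_congr_ae (.of_forall fun y => ?_)
  simp only [hw, conjSchwartz_apply, timeFreqShift_apply, smul_eq_mul, Prod.fst_sub, Prod.snd_sub,
    sub_zero, character_sub_left, map_mul, Complex.conj_conj]
  ring

/-- The shift by `(0, a)` costs at most `(1 + ‖e‖)^N`, which the Schwartz weight `m` absorbs. The
constant is uniform in `lam` apart from its sup norm, hence boundedness into `M^p` for all `p ≥ 1`
at once. -/
theorem exists_norm_stft_synthesis_le (g X : 𝓢(Eu d, ℂ)) (hX : HasCompactSupport X)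
    (m : 𝓢(Triple d, ℂ)) (N : ℕ) :
    ∃ C, 0 ≤ C ∧ ∀ lam z, ‖stft g (synthesis X hX m lam : 𝓢'(Eu d, ℂ)) z‖ ≤
      ‖lam‖ * (C * decayWeight N z) := by
  obtain ⟨A, hA, h⟩ := exists_norm_stft_coe_le g X N
  have hm := integrable_weighted_norm volume m N
  set I := ∫ e, (1 + ‖e‖) ^ N * ‖m e‖
  have hI : 0 ≤ I := integral_nonneg fun e => by positivity
  refine ⟨2 * A * I, by positivity, fun lam z => ?_⟩
  have hD := decayWeight_nonneg N z
  rw [stft_synthesis]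
  calc _ ≤ ∫ e, (2 * ‖lam‖ * A * decayWeight N z) * ((1 + ‖e‖) ^ N * ‖m e‖) := by
        refine norm_integral_le_of_norm_le (hm.const_mul _) (.of_forall fun e => ?_)
        have h1 : ‖((0 : Eu d), spacePart e)‖ ≤ ‖e‖ := by
          rw [Prod.norm_def, norm_zero]
          exact max_le (norm_nonneg _) (norm_spacePart_le e)
        have h2 : ‖stft g (X : 𝓢'(Eu d, ℂ)) (z - ((0 : Eu d), spacePart e))‖ ≤
            A * ((1 + ‖e‖) ^ N * decayWeight N z) := by
          refine (h _).trans (mul_le_mul_of_nonneg_left ((decayWeight_sub_le N z _).trans ?_) hA)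
          gcongr
        rw [norm_mul, norm_mul]
        calc _ ≤ ‖m e‖ * (2 * ‖lam‖) * (A * ((1 + ‖e‖) ^ N * decayWeight N z)) := by
              gcongr
              exact norm_dyadicSum_le lam e
          _ = _ := by ring
    _ = _ := by
        rw [integral_const_mul]
        ring

theorem exists_cutoff_schwartz {R : ℝ} (hR : 0 < R) :
    ∃ X : 𝓢(Eu d, ℂ), HasCompactSupport X ∧ ∀ x, ‖x‖ ≤ R → X x = 1 := by
  let χ : ContDiffBump (0 : Eu d) := ⟨R, 2 * R, hR, by linarith⟩
  have h1 : HasCompactSupport (Complex.ofRealCLM ∘ χ) := χ.hasCompactSupport.comp_left rfl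
  have h2 : ContDiff ℝ ∞ (Complex.ofRealCLM ∘ χ) := Complex.ofRealCLM.contDiff.comp χ.contDiff
  refine ⟨h1.toSchwartzMap h2, h1, fun x hx => ?_⟩
  show ((χ x : ℝ) : ℂ) = 1
  rw [χ.one_of_mem_closedBall (by simpa using hx), Complex.ofReal_one]

/-! ### Sampling a distribution on translates. -/

theorem continuous_apply_translate (f : 𝓢'(Eu d, ℂ)) (Ψ : 𝓢(Eu d, ℂ)) :
    Continuous fun b => f (compSubConstCLM ℂ b Ψ) :=
  (map_continuous f).comp (continuous_translate.comp (continuous_id.prodMk continuous_const))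

theorem exists_bound_apply_translate {g : 𝓢(Eu d, ℂ)} (hg : g ≠ 0) (Ψ : 𝓢(Eu d, ℂ))
    {p : ℝ≥0∞} (hp : 1 ≤ p) (f : modSpace g p) :
    ∃ C : ℝ, ∀ b, ‖(f : 𝓢'(Eu d, ℂ)) (compSubConstCLM ℂ b Ψ)‖ ≤ C := by
  obtain ⟨C, hC⟩ := exists_enorm_apply_translate_le hg Ψ hp
  have hf : modNorm g p f ≠ ⊤ := f.2.2.ne
  refine ⟨(C * modNorm g p f).toReal, fun b => ?_⟩
  rw [← toReal_enorm]
  exact ENNReal.toReal_mono (ENNReal.mul_ne_top ENNReal.coe_ne_top hf) (hC f b)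

/-- The bounded continuous function `b ↦ f(Ψ(· - b))`. -/
def sample {g : 𝓢(Eu d, ℂ)} (hg : g ≠ 0) (Ψ : 𝓢(Eu d, ℂ)) {p : ℝ≥0∞} (hp : 1 ≤ p) :
    modSpace g p →ₗ[ℂ] BoundedContinuousFunction (Eu d) ℂ where
  toFun f := BoundedContinuousFunction.ofNormedAddCommGroup
    (fun b => (f : 𝓢'(Eu d, ℂ)) (compSubConstCLM ℂ b Ψ)) (continuous_apply_translate f Ψ)
    (exists_bound_apply_translate hg Ψ hp f).choose
    (exists_bound_apply_translate hg Ψ hp f).choose_spec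
  map_add' f₁ f₂ := by ext b; rfl
  map_smul' c f := by ext b; rfl

theorem sample_apply {g : 𝓢(Eu d, ℂ)} (hg : g ≠ 0) (Ψ : 𝓢(Eu d, ℂ)) {p : ℝ≥0∞} (hp : 1 ≤ p)
    (f : modSpace g p) (b : Eu d) :
    sample hg Ψ hp f b = (f : 𝓢'(Eu d, ℂ)) (compSubConstCLM ℂ b Ψ) := rfl

theorem exists_enorm_sample_le {g : 𝓢(Eu d, ℂ)} (hg : g ≠ 0) (Ψ : 𝓢(Eu d, ℂ)) {p : ℝ≥0∞}
    (hp : 1 ≤ p) : ∃ C : ℝ≥0, ∀ f : modSpace g p,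
      ‖sample hg Ψ hp f‖ₑ ≤ C * modNorm g p f := by
  obtain ⟨C, hC⟩ := exists_enorm_apply_translate_le hg Ψ hp
  refine ⟨C, fun f => ?_⟩
  have hf : modNorm g p f ≠ ⊤ := f.2.2.ne
  have ht : C * modNorm g p f ≠ ⊤ := ENNReal.mul_ne_top ENNReal.coe_ne_top hf
  rw [← ofReal_norm]
  refine ENNReal.ofReal_le_of_le_toReal ?_
  refine (BoundedContinuousFunction.norm_le ENNReal.toReal_nonneg).2 fun b => ?_
  rw [sample_apply, ← toReal_enorm]
  exact ENNReal.toReal_mono ht (hC f b)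

/-! ### Identification with the integral operator on Schwartz functions. -/

/-- The translate is the Fourier transform of a modulation of `X`, and the Fourier transform moves
onto `u` by the multiplication formula. -/
theorem coe_apply_translate_fourier (u X : 𝓢(Eu d, ℂ)) (b : Eu d) :
    (u : 𝓢'(Eu d, ℂ)) (compSubConstCLM ℂ b (𝓕 X)) = ∫ η, character b η * (X η * 𝓕 u η) := by
  rw [coe_apply, ← fourier_modulate]
  simp only [smul_eq_mul]
  rw [integral_fourier_mul_eq]
  refine integral_congr_ae (.of_forall fun η => ?_)
  simp only [SchwartzMap.smulLeftCLM_apply_apply (hasTemperateGrowth_character b), smul_eq_mul]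
  ring

/-- If the values `λ(b)` are Fourier coefficients of an integrable function, the superposition is
an integral against the sum of dyadic dilates. -/
theorem superposition_eq_integral (M : 𝓢(Triple d, ℂ)) {G : Eu d → ℂ} (hG : Integrable G)
    (lam : BoundedContinuousFunction (Eu d) ℂ) (hlam : ∀ b, lam b = ∫ η, character b η * G η)
    {K : Eu d → ℂ} (x : Eu d)
    (hK : ∀ᵐ η : Eu d, HasSum (fun j : ℕ => (2⁻¹ : ℂ) ^ j *
      M (triple ((2⁻¹ : ℝ) ^ j) x ((2 : ℝ) ^ j • η))) (K η)) :
    superposition (𝓕 M) lam x = ∫ η, K η * G η := by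
  set m : 𝓢(Triple d, ℂ) := 𝓕 M with hm
  let c : ℕ → Triple d → ℂ := fun j e =>
    (2⁻¹ : ℂ) ^ j * Real.fourierChar (scalePart e * (2⁻¹ : ℝ) ^ j)
  have hcc : ∀ j, Continuous (c j) := fun j =>
    continuous_const.mul (continuous_subtype_val.comp
      (Real.continuous_fourierChar.comp (by fun_prop)))
  have hcn : ∀ j e, ‖c j e‖ = (2⁻¹ : ℝ) ^ j := fun j e => by
    simp only [c]
    rw [norm_mul, Circle.norm_coe, mul_one, norm_pow, norm_inv, Complex.norm_ofNat]
  have hleft : HasSum (fun j : ℕ => ∫ e, m e * (c j e * lam ((2 : ℝ) ^ j • freqPart e)) *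
      character (spacePart e) x) (superposition m lam x) := by
    have hb : ∀ j e, ‖m e * (c j e * lam ((2 : ℝ) ^ j • freqPart e)) *
        character (spacePart e) x‖ ≤ (2⁻¹ : ℝ) ^ j * (‖lam‖ * ‖m e‖) := fun j e => by
      rw [norm_mul, norm_mul, norm_character, mul_one, mul_comm, ← mul_assoc]
      exact mul_le_mul_of_nonneg_right (norm_dyadicSum_term_le lam j e) (norm_nonneg _)
    have hi : ∀ j, Integrable fun e => m e * (c j e * lam ((2 : ℝ) ^ j • freqPart e)) *
        character (spacePart e) x := fun j => by
      have := continuous_dyadicSum_term lam j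
      exact ((m.integrable.norm.const_mul ‖lam‖).const_mul ((2⁻¹ : ℝ) ^ j)).mono'
        (Continuous.aestronglyMeasurable (by fun_prop)) (.of_forall (hb j))
    have hs := hasSum_integral_of_summable_integral_norm hi
      (.of_nonneg_of_le (fun j => integral_nonneg fun e => norm_nonneg _) (fun j => by
        refine (integral_mono (hi j).norm
          ((m.integrable.norm.const_mul ‖lam‖).const_mul ((2⁻¹ : ℝ) ^ j)) (hb j)).trans_eq ?_
        rw [integral_const_mul]) (summable_inv_two_pow.mul_right _))
    have heq : superposition m lam x = ∫ e, ∑' j : ℕ,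
        m e * (c j e * lam ((2 : ℝ) ^ j • freqPart e)) * character (spacePart e) x := by
      refine integral_congr_ae (.of_forall fun e => ?_)
      simp only [dyadicSum]
      rw [← tsum_mul_left, ← tsum_mul_right]
    rw [heq]
    exact hs
  have hright : HasSum (fun j : ℕ => ∫ η, (2⁻¹ : ℂ) ^ j *
      M (triple ((2⁻¹ : ℝ) ^ j) x ((2 : ℝ) ^ j • η)) * G η) (∫ η, K η * G η) := by
    set S := SchwartzMap.seminorm ℝ 0 0 M
    have hb : ∀ j η, ‖(2⁻¹ : ℂ) ^ j * M (triple ((2⁻¹ : ℝ) ^ j) x ((2 : ℝ) ^ j • η)) * G η‖ ≤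
        (2⁻¹ : ℝ) ^ j * (S * ‖G η‖) := fun j η => by
      rw [norm_mul, norm_mul, norm_pow, norm_inv, Complex.norm_ofNat, mul_assoc]
      gcongr
      exact SchwartzMap.norm_le_seminorm ℝ M _
    have hcont : ∀ j : ℕ, Continuous fun η : Eu d =>
        M (triple ((2⁻¹ : ℝ) ^ j) x ((2 : ℝ) ^ j • η)) := fun j => by
      have : Continuous fun η : Eu d => triple ((2⁻¹ : ℝ) ^ j) x ((2 : ℝ) ^ j • η) :=
        (tripleEquiv d).symm.continuous.comp
          (f := fun η : Eu d => ((2⁻¹ : ℝ) ^ j, x, (2 : ℝ) ^ j • η)) (by fun_prop)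
      exact M.continuous.comp this
    have hi : ∀ j, Integrable fun η => (2⁻¹ : ℂ) ^ j *
        M (triple ((2⁻¹ : ℝ) ^ j) x ((2 : ℝ) ^ j • η)) * G η := fun j =>
      ((hG.norm.const_mul S).const_mul ((2⁻¹ : ℝ) ^ j)).mono'
        ((continuous_const.mul (hcont j)).aestronglyMeasurable.mul hG.aestronglyMeasurable)
        (.of_forall (hb j))
    have hs := hasSum_integral_of_summable_integral_norm hi
      (.of_nonneg_of_le (fun j => integral_nonneg fun e => norm_nonneg _) (fun j => by
        refine (integral_mono (hi j).norm
          ((hG.norm.const_mul S).const_mul ((2⁻¹ : ℝ) ^ j)) (hb j)).trans_eq ?_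
        rw [integral_const_mul]) (summable_inv_two_pow.mul_right _))
    have heq : ∫ η, K η * G η = ∫ η, ∑' j : ℕ, (2⁻¹ : ℂ) ^ j *
        M (triple ((2⁻¹ : ℝ) ^ j) x ((2 : ℝ) ^ j • η)) * G η := by
      refine integral_congr_ae ?_
      filter_upwards [hK] with η hη
      rw [tsum_mul_right, hη.tsum_eq]
    rw [heq]
    exact hs
  -- Both sides are now sums over `j`, so it remains to match the `j`-th terms, by Fourier inversion
  -- of `M` and Fubini.
  refine hleft.unique ?_
  convert hright using 1
  funext j
  have hI : Integrable (Function.uncurry fun (e : Triple d) (η : Eu d) =>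
      (c j e * character (spacePart e) x * character ((2 : ℝ) ^ j • freqPart e) η) *
        (m e * G η)) (volume.prod volume) := by
    have hcj := hcc j
    refine (m.integrable.mul_prod hG).bdd_mul (c := (2⁻¹ : ℝ) ^ j)
      (f := fun q : Triple d × Eu d =>
        c j q.1 * character (spacePart q.1) x * character ((2 : ℝ) ^ j • freqPart q.1) q.2)
      (Continuous.aestronglyMeasurable (by fun_prop)) (.of_forall fun q => ?_)
    rw [norm_mul, norm_mul, norm_character, norm_character, hcn, mul_one, mul_one]
  have e1 : ∫ e, m e * (c j e * lam ((2 : ℝ) ^ j • freqPart e)) * character (spacePart e) x =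
      ∫ e, ∫ η, (c j e * character (spacePart e) x *
        character ((2 : ℝ) ^ j • freqPart e) η) * (m e * G η) := by
    refine integral_congr_ae (.of_forall fun e => ?_)
    simp only
    rw [hlam, show m e * (c j e * ∫ η, character ((2 : ℝ) ^ j • freqPart e) η * G η) *
      character (spacePart e) x = (m e * c j e * character (spacePart e) x) *
        ∫ η, character ((2 : ℝ) ^ j • freqPart e) η * G η by ring, ← integral_const_mul]
    refine integral_congr_ae (.of_forall fun η => ?_)
    simp only
    ring
  rw [e1, integral_integral_swap hI]
  refine integral_congr_ae (.of_forall fun η => ?_)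
  simp only
  rw [schwartz_triple_eq_integral, ← hm, ← integral_const_mul, ← integral_mul_const]
  refine integral_congr_ae (.of_forall fun e => ?_)
  -- The dilation passes from `η` to the dual variable; this is why `lam` is sampled at `2^j` times
  -- the frequency component.
  have hch : character (freqPart e) ((2 : ℝ) ^ j • η) =
      character ((2 : ℝ) ^ j • freqPart e) η := by
    rw [character, character, real_inner_smul_left, real_inner_smul_right]
  simp only [hch, c]
  ring

/-! ### The extension and its boundedness. -/

section Main

variable {σ : Eu d → Eu d → ℂ} {R : ℝ} {Φ : Eu d → Eu d → ℝ}

theorem isGivenBy_coe (h : 𝓢(Eu d, ℂ)) : IsGivenBy (h : 𝓢'(Eu d, ℂ)) h := by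
  refine ⟨h.integrable.locallyIntegrable, fun φ => ⟨?_, ?_⟩⟩
  · exact h.integrable.bdd_mul (c := SchwartzMap.seminorm ℝ 0 0 φ)
      φ.continuous.aestronglyMeasurable
      (.of_forall fun y => SchwartzMap.norm_le_seminorm ℝ φ y)
  · rw [coe_apply]
    rfl

/-- The cutoffs `X(x)` and `X(η)` may be inserted freely, since both equal `1` wherever `σ` is
nonzero. -/
theorem fio_eq_synthesis (hσR : ∀ x η : Eu d, R ≤ ‖x‖ + ‖η‖ → σ x η = 0)
    {M : 𝓢(Triple d, ℂ)} (hM : ∀ x, ∀ᵐ η : Eu d,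
      HasSum (fun j : ℕ => (2⁻¹ : ℂ) ^ j * M (triple ((2⁻¹ : ℝ) ^ j) x ((2 : ℝ) ^ j • η)))
        (Complex.exp (2 * Real.pi * Complex.I * Φ x η) * σ x η))
    {X : 𝓢(Eu d, ℂ)} (hX : HasCompactSupport X) (hX1 : ∀ x, ‖x‖ ≤ R → X x = 1)
    (u : 𝓢(Eu d, ℂ)) (lam : BoundedContinuousFunction (Eu d) ℂ)
    (hlam : ∀ b, lam b = (u : 𝓢'(Eu d, ℂ)) (compSubConstCLM ℂ b (𝓕 X))) :
    fio Φ σ u = synthesis X hX (𝓕 M) lam := by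
  have hG : Integrable fun η => X η * 𝓕 u η :=
    (𝓕 u).integrable.bdd_mul (c := SchwartzMap.seminorm ℝ 0 0 X)
      X.continuous.aestronglyMeasurable
      (.of_forall fun y => SchwartzMap.norm_le_seminorm ℝ X y)
  funext x
  rw [synthesis_apply, superposition_eq_integral M hG lam
    (fun b => (hlam b).trans (coe_apply_translate_fourier u X b)) x (hM x), fio,
    ← integral_const_mul]
  refine integral_congr_ae (.of_forall fun η => ?_)
  simp only
  rw [← fourier_coe]
  by_cases hη : R ≤ ‖x‖ + ‖η‖
  · rw [hσR x η hη]
    simp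
  · rw [hX1 x (by linarith [norm_nonneg η]), hX1 η (by linarith [norm_nonneg x])]
    ring

/-- The extension is synthesis after sampling, and its values are Schwartz functions. It therefore
maps into any `S` lying between the Schwartz space and `M^p`, which treats `M^p` and the closure in
`M^∞` together. -/
theorem extendsToBounded_fio
    (hσ : ContDiff ℝ ∞ (fun z : Eu d × Eu d => σ z.1 z.2)) (hR : 0 < R)
    (hσR : ∀ x η : Eu d, R ≤ ‖x‖ + ‖η‖ → σ x η = 0)
    (hΦ : ContDiffOn ℝ ∞ (fun z : Eu d × Eu d => Φ z.1 z.2) (Set.univ ×ˢ {0}ᶜ))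
    (hΦ_hom : ∀ (x η : Eu d) (t : ℝ), η ≠ 0 → 0 < t → Φ x (t • η) = t * Φ x η)
    {g : 𝓢(Eu d, ℂ)} (hg : g ≠ 0) {p : ℝ≥0∞} (hp : 1 ≤ p)
    {S : Submodule ℂ 𝓢'(Eu d, ℂ)} (hS : S ≤ modSpace g p)
    (hS' : ∀ u : 𝓢(Eu d, ℂ), (u : 𝓢'(Eu d, ℂ)) ∈ S) :
    ExtendsToBounded (fio Φ σ) S (modNorm g p) := by
  obtain ⟨M, hM⟩ := exists_dyadic_representation hσ hR hσR hΦ hΦ_hom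
  obtain ⟨X, hX, hX1⟩ := exists_cutoff_schwartz (d := d) hR
  obtain ⟨C, hC⟩ := exists_enorm_sample_le hg (𝓕 X) hp
  obtain ⟨D, hD, hDb⟩ := exists_norm_stft_synthesis_le g X hX (𝓕 M) (2 * d + 1)
  have hW := (memLp_decayWeight (V := Eu d × Eu d) finrank_phaseSpace_lt volume hp).const_mul D
  let L : S →ₗ[ℂ] 𝓢(Eu d, ℂ) :=
    synthesis X hX (𝓕 M) ∘ₗ sample hg (𝓕 X) hp ∘ₗ Submodule.inclusion hS
  let A : S →ₗ[ℂ] S := LinearMap.codRestrict S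
    ((toTemperedDistributionCLM (Eu d) ℂ volume).toLinearMap ∘ₗ L) fun f => hS' _
  refine ⟨A, fun u => ⟨hS' u, ?_⟩,
    C * (eLpNorm (fun z : Eu d × Eu d => D * decayWeight (2 * d + 1) z) p volume).toNNReal,
    fun f => ?_⟩
  · have h1 : fio Φ σ u = L ⟨u, hS' u⟩ := fio_eq_synthesis hσR hM hX hX1 u _ fun b => rfl
    rw [h1]
    exact isGivenBy_coe _
  · set lam := sample hg (𝓕 X) hp (Submodule.inclusion hS f) with hlam
    have h1 : modNorm g p (A f : 𝓢'(Eu d, ℂ)) ≤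
        ‖lam‖ₑ * eLpNorm (fun z : Eu d × Eu d => D * decayWeight (2 * d + 1) z) p volume := by
      have h2 : modNorm g p (A f : 𝓢'(Eu d, ℂ)) ≤ eLpNorm (fun z : Eu d × Eu d =>
          ‖lam‖ * (D * decayWeight (2 * d + 1) z)) p volume :=
        eLpNorm_mono_real fun z => hDb lam z
      refine h2.trans_eq ?_
      have h3 := eLpNorm_const_smul (μ := volume) (p := p) ‖lam‖
        (fun z : Eu d × Eu d => D * decayWeight (2 * d + 1) z)
      rw [enorm_norm] at h3
      exact h3
    refine h1.trans ?_
    rw [ENNReal.coe_mul, ENNReal.coe_toNNReal hW.2.ne, mul_right_comm]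
    gcongr
    exact hC (Submodule.inclusion hS f)

theorem modSpaceInfty_le (g : 𝓢(Eu d, ℂ)) : modSpaceInfty g ≤ modSpace g ⊤ := fun _ h => h.1

theorem coe_mem_modSpaceInfty (g u : 𝓢(Eu d, ℂ)) : (u : 𝓢'(Eu d, ℂ)) ∈ modSpaceInfty g := by
  refine ⟨coe_mem_modSpace g u le_top, fun ε hε => ⟨u, coe_mem_modSpace g u le_top, ?_⟩⟩
  rw [sub_self, modNorm, stft_zero, eLpNorm_zero]
  exact hε

end Main

end ModulationFIO

end

theorem proposition4p1 {d : ℕ}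
    (σ : ModulationFIO.Eu d → ModulationFIO.Eu d → ℂ)
    (hσ : ContDiff ℝ ∞ (fun z : ModulationFIO.Eu d × ModulationFIO.Eu d => σ z.1 z.2))
    (R : ℝ) (hR : 0 < R)
    (hσR : ∀ x η : ModulationFIO.Eu d, R ≤ ‖x‖ + ‖η‖ → σ x η = 0)
    (Φ : ModulationFIO.Eu d → ModulationFIO.Eu d → ℝ)
    (hΦ : ContDiffOn ℝ ∞ (fun z : ModulationFIO.Eu d × ModulationFIO.Eu d => Φ z.1 z.2)
      (Set.univ ×ˢ {0}ᶜ))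
    (hΦ_hom : ∀ (x η : ModulationFIO.Eu d) (t : ℝ), η ≠ 0 → 0 < t → Φ x (t • η) = t * Φ x η)
    (g : 𝓢(ModulationFIO.Eu d, ℂ)) (hg : g ≠ 0) :
    (∀ p : ℝ≥0∞, 1 ≤ p → p < ⊤ →
      ModulationFIO.ExtendsToBounded (ModulationFIO.fio Φ σ) (ModulationFIO.modSpace g p)
        (ModulationFIO.modNorm g p)) ∧
    ModulationFIO.ExtendsToBounded (ModulationFIO.fio Φ σ) (ModulationFIO.modSpaceInfty g)
      (ModulationFIO.modNorm g ⊤) := by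
  refine ⟨fun p hp _ => ?_, ?_⟩
  · exact ModulationFIO.extendsToBounded_fio hσ hR hσR hΦ hΦ_hom hg hp le_rfl
      fun u => ModulationFIO.coe_mem_modSpace g u hp
  · exact ModulationFIO.extendsToBounded_fio hσ hR hσR hΦ hΦ_hom hg le_top
      (ModulationFIO.modSpaceInfty_le g) (ModulationFIO.coe_mem_modSpaceInfty g)
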